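/- Fix $q_1,q_2>0$, $K>0$, an integer $n_0\ge 0$, and put $\alpha=\frac{1}{2(q_1+q_2)}$. Let $\Theta$ be the class of all simulation outputs $\hat\theta(\delta)=\theta+b(\delta)+\varepsilon(\delta)/\delta^{q_2}$, $\delta>0$, where $\theta\in\mathbb R$ is arbitrary, $b(\delta)=B\delta^{q_1}+o(\delta^{q_1})$ as $\delta\downarrow0$ for some $B\ne0$, and, for each $\delta>0$, $\varepsilon(\delta)$ is a real random variable with mean $0$ and finite variance such that $\mathrm{Var}(\varepsilon(\delta))\to\sigma^2$ as $\delta\downarrow 0$ for some $\sigma^2>0$. For $d>0$ let $\mathrm{MSE}_0(\hat\theta(\cdot),d)$ be the mean squared error, as an estimator of $\theta$, of the average of $n$ independent runs of $\hat\theta(\delta)$ with $\delta=d(n+n_0)^{-\alpha}$. For $\tilde d>0$ and weights $w^{(n)}=(w_{j,n})_{j=1,\dots,n}\in\mathbb R^n$ let $\mathrm{MSE}_1^{gen}(\hat\theta(\cdot),\tilde d,w^{(n)})$ be the mean squared error of $\sum_{j=1}^n w_{j,n}\hat\theta_j(\delta_j)$, where $\hat\theta_1(\delta_1),\dots,\hat\theta_n(\delta_n)$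 are independent runs with $\delta_j=\tilde d(j+n_0)^{-\alpha}$. For a triangular array $W=\{w^{(n)}\}_{n\ge1}$ put $$R^{gen}(\hat\theta(\cdot),d,\tilde d,W)=\limsup_{n\to\infty}\frac{\mathrm{MSE}_1^{gen}(\hat\theta(\cdot),\tilde d,w^{(n)})}{\mathrm{MSE}_0(\hat\theta(\cdot),d)}\in[0,\infty].$$ Let $\mathcal W$ be the set of all triangular arrays and $\mathcal F_K=\{g:(0,\infty)\to(0,\infty):\ g(d)\le Kd\text{ for all }d>0\}$. Then for every fixed $d>0$, $$\min_{\substack{\tilde d=g(d):\,g\in\mathcal F_K\\ W\in\mathcal W}}\ \sup_{\hat\theta(\cdot)\in\Theta}R^{gen}(\hat\theta(\cdot),d,\tilde d,W)=\frac{q_1}{q_1+q_2}\,\frac1{K^{2q_2}} .$$ The minimum is attained by $\tilde d=Kd$ together with any array $W^*=(w^*_{j,n})$ that for all sufficiently large $n$ has the form $$w_{j,n}^*=\frac{\lambda_1^*}{(j+n_0)^{(q_1+2q_2)/(2(q_1+q_2))}}+\frac{\lambda_2^*}{(j+n_0)^{q_2/(q_1+q_2)}},\qquad \begin{bmatrix}\lambda_1^*\\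 \lambda_2^*\end{bmatrix}=\begin{bmatrix}\xi_{11}&\xi_{12}\\ \xi_{21}&\xi_{22}\end{bmatrix}\begin{bmatrix}a^*\\1\end{bmatrix},$$ where, with $\phi(\kappa)=\sum_{j=1}^n (j+n_0)^{-\kappa}$, $$\begin{bmatrix}\xi_{11}&\xi_{12}\\ \xi_{21}&\xi_{22}\end{bmatrix}=\begin{bmatrix}\phi(1)&\phi\!\left(\frac{q_1+2q_2}{2(q_1+q_2)}\right)\\ \phi\!\left(\frac{q_1+2q_2}{2(q_1+q_2)}\right)&\phi\!\left(\frac{q_2}{q_1+q_2}\right)\end{bmatrix}^{-1}$$ and $a^*$ is an optimal solution to $$\min_{a:\,(K^{2(q_1+q_2)}-\xi_{11})a^2-2\xi_{12}a-\xi_{22}\ge0}\ |a|^{2q_2/(q_1+q_2)}\left(\xi_{11}a^2+2\xi_{12}a+\xi_{22}\right)^{q_1/(q_1+q_2)}.$$ Such arrays exist, and for $\tilde d=Kd$ and any of them the supremum over $\Theta$ is attained. -/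

import Mathlib

open MeasureTheory ProbabilityTheory Filter Topology Asymptotics
open scoped ENNReal

noncomputable section

/-- A simulation output `δ ↦ θ + b(δ) + ε(δ) / δ ^ q₂`, in which the noise variable `ε(δ)` is given
by its law. Only positive values of the tuning parameter `δ` are ever used. -/
structure SimOutput where
  /-- the unknown target -/
  θ : ℝ
  /-- the bias `b(δ)` -/
  bias : ℝ → ℝ
  /-- the law of `ε(δ)` -/
  noise : ℝ → ProbabilityMeasure ℝ

/-- The law of one run `θ + b(δ) + ε(δ) / δ ^ q₂` with tuning parameter `δ`. -/
def SimOutput.law (M : SimOutput) (q₂ δ : ℝ) : Measure ℝ :=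
  (M.noise δ : Measure ℝ).map (fun e => M.θ + M.bias δ + e / δ ^ q₂)

/-- The model class `Θ`: the target is arbitrary, `b(δ) = B δ ^ q₁ + o(δ ^ q₁)` for some `B ≠ 0`,
and `ε(δ)` is centred with finite variance tending to some `σ² > 0` as `δ ↓ 0`. -/
def modelClass (q₁ : ℝ) : Set SimOutput :=
  {M | (∃ B : ℝ, B ≠ 0 ∧
          (fun δ : ℝ => M.bias δ - B * δ ^ q₁) =o[𝓝[>] 0] (fun δ : ℝ => δ ^ q₁)) ∧
       (∀ δ : ℝ, 0 < δ → MemLp (fun e : ℝ => e) 2 (M.noise δ : Measure ℝ) ∧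
          ∫ e, e ∂(M.noise δ : Measure ℝ) = 0) ∧
       (∃ σ2 : ℝ, 0 < σ2 ∧
          Tendsto (fun δ : ℝ => variance (fun e : ℝ => e) (M.noise δ : Measure ℝ))
            (𝓝[>] 0) (𝓝 σ2))}

/-- The exponent `α = 1 / (2 (q₁ + q₂))`. -/
def rateExp (q₁ q₂ : ℝ) : ℝ := 1 / (2 * (q₁ + q₂))

/-- The mean squared error `E (∑ i, w i * X i - θ) ^ 2` of a weighted sum of independent runs `X i`,
the run `i` having tuning parameter `δ i`. -/
def weightedMSE (M : SimOutput) (q₂ : ℝ) {n : ℕ} (δ w : Fin n → ℝ) : ℝ≥0∞ :=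
  ∫⁻ x : Fin n → ℝ, ENNReal.ofReal ((∑ i, w i * x i - M.θ) ^ 2)
    ∂(Measure.pi fun i => M.law q₂ (δ i))

/-- The mean squared error of the baseline: the average of `n` independent runs, all with
`δ = d (n + n₀) ^ (-α)`. -/
def baselineMSE (M : SimOutput) (q₁ q₂ : ℝ) (n₀ : ℕ) (d : ℝ) (n : ℕ) : ℝ≥0∞ :=
  weightedMSE M q₂ (n := n) (fun _ => d * ((n : ℝ) + n₀) ^ (-rateExp q₁ q₂)) (fun _ => 1 / (n : ℝ))

/-- Triangular arrays of weights. The run number of `i : Fin n` is `j = i + 1`. -/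
abbrev WeightArray : Type := (n : ℕ) → Fin n → ℝ

/-- The mean squared error of the general weighted estimator `∑ j ≤ n, w j * θ̂_j(δ_j)`, where
`δ_j = d' (j + n₀) ^ (-α)`. -/
def generalMSE (M : SimOutput) (q₁ q₂ : ℝ) (n₀ : ℕ) (d' : ℝ) {n : ℕ} (w : Fin n → ℝ) : ℝ≥0∞ :=
  weightedMSE M q₂ (fun i : Fin n => d' * (((i : ℝ) + 1) + n₀) ^ (-rateExp q₁ q₂)) w

/-- The asymptotic risk ratio of the general weighted estimator against the baseline. -/
def riskRatio (M : SimOutput) (q₁ q₂ : ℝ) (n₀ : ℕ) (d d' : ℝ) (W : WeightArray) : ℝ≥0∞ :=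
  limsup (fun n : ℕ => generalMSE M q₁ q₂ n₀ d' (W n) / baselineMSE M q₁ q₂ n₀ d n) atTop

/-- Calibration functions with inflation factor at most `K`. -/
def calibrations (K : ℝ) : Set (ℝ → ℝ) :=
  {g | ∀ d : ℝ, 0 < d → 0 < g d ∧ g d ≤ K * d}

/-- `φ(κ) = ∑ j ≤ n, 1 / (j + n₀) ^ κ`. -/
def phiSum (n₀ n : ℕ) (κ : ℝ) : ℝ :=
  ∑ i : Fin n, 1 / (((i : ℝ) + 1) + n₀) ^ κ

/-- The matrix `ξ`. -/
def xiMatrix (q₁ q₂ : ℝ) (n₀ n : ℕ) : Matrix (Fin 2) (Fin 2) ℝ :=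
  (!![phiSum n₀ n 1, phiSum n₀ n ((q₁ + 2 * q₂) / (2 * (q₁ + q₂)));
      phiSum n₀ n ((q₁ + 2 * q₂) / (2 * (q₁ + q₂))), phiSum n₀ n (q₂ / (q₁ + q₂))])⁻¹

/-- The feasible set of the one-dimensional program that determines `a`. -/
def feasibleSet (q₁ q₂ K : ℝ) (n₀ n : ℕ) : Set ℝ :=
  {a | 0 ≤ (K ^ (2 * (q₁ + q₂)) - xiMatrix q₁ q₂ n₀ n 0 0) * a ^ 2
          - 2 * xiMatrix q₁ q₂ n₀ n 0 1 * a - xiMatrix q₁ q₂ n₀ n 1 1}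

/-- The objective of the one-dimensional program that determines `a`. -/
def objective (q₁ q₂ : ℝ) (n₀ n : ℕ) (a : ℝ) : ℝ :=
  |a| ^ (2 * q₂ / (q₁ + q₂)) *
    (xiMatrix q₁ q₂ n₀ n 0 0 * a ^ 2 + 2 * xiMatrix q₁ q₂ n₀ n 0 1 * a
      + xiMatrix q₁ q₂ n₀ n 1 1) ^ (q₁ / (q₁ + q₂))

/-- `w` is a sequence of `n` two-decay weights, built from some optimal solution `a`. -/
def IsTwoDecay (q₁ q₂ K : ℝ) (n₀ : ℕ) {n : ℕ} (w : Fin n → ℝ) : Prop :=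
  ∃ a ∈ feasibleSet q₁ q₂ K n₀ n,
    IsMinOn (objective q₁ q₂ n₀ n) (feasibleSet q₁ q₂ K n₀ n) a ∧
    ∀ i : Fin n,
      w i = (xiMatrix q₁ q₂ n₀ n).mulVec ![a, 1] 0
                / (((i : ℝ) + 1) + n₀) ^ ((q₁ + 2 * q₂) / (2 * (q₁ + q₂)))
            + (xiMatrix q₁ q₂ n₀ n).mulVec ![a, 1] 1
                / (((i : ℝ) + 1) + n₀) ^ (q₂ / (q₁ + q₂))

/-- The array consists of two-decay weights for all sufficiently large `n`. (For small `n` the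
matrix may be singular, as for `n = 1`, or the program infeasible.) -/
def IsTwoDecayArray (q₁ q₂ K : ℝ) (n₀ : ℕ) (W : WeightArray) : Prop :=
  ∀ᶠ n in atTop, IsTwoDecay q₁ q₂ K n₀ (W n)

end

/-! Write β = q₁/(2(q₁+q₂)) and T = (n+n₀)^β. With the prescribed tuning, run j has bias of order
(j+n₀)^(-β) and variance of order (j+n₀)^(1-2β), and T² times the baseline error tends to B²d^(2q₁)
+ σ²/d^(2q₂).

Lower bound (`le_iSup_riskRatio`): the target is arbitrary, so a bounded risk forces the weights to
sum to 1 in the limit (`tendsto_sum_weights`). As φ(1-2β) ~ T²/(2β), Cauchy-Schwarz keeps T² times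
the variance asymptotically above 2βσ²/d'^(2q₂). When B → 0 the baseline is pure variance, which
leaves a ratio of at least 2β(d/d')^(2q₂) ≥ 2βK^(-2q₂).

Upper bound (`riskRatio_twoDecay`): two-decay weights are the Lagrange solution of minimising ∑
w_j²(j+n₀)^(1-2β) subject to ∑ w_j = 1 and ∑ w_j(j+n₀)^(-β) = a. Since φ(1) diverges, prescribing a
= u/T costs no noise in the limit: T² times the least noise still tends to 2β
(`tendsto_noiseFactor`). The program for a drives |T a| to the edge of feasibility,
√(2β/K^(2(q₁+q₂))) (`tendsto_abs_optimal`). At d' = Kd the squared bias and the variance are then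
both 2βK^(-2q₂) times their baseline counterparts, so every model has the same ratio. -/

/-! ### Bias-variance decomposition. -/

/-- The bias-variance form of the mean squared error of a weighted sum of independent runs. -/
noncomputable def biasVarianceMSE (M : SimOutput) (q₂ : ℝ) {n : ℕ} (δ w : Fin n → ℝ) : ℝ :=
  (M.θ * (∑ i, w i - 1) + ∑ i, w i * M.bias (δ i)) ^ 2 +
    ∑ i, w i ^ 2 * (variance (fun e : ℝ => e) (M.noise (δ i) : Measure ℝ) / (δ i ^ q₂) ^ 2)

lemma biasVarianceMSE_nonneg (M : SimOutput) (q₂ : ℝ) {n : ℕ} (δ w : Fin n → ℝ) :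
    0 ≤ biasVarianceMSE M q₂ δ w := by
  unfold biasVarianceMSE
  have : ∀ i, 0 ≤ variance (fun e : ℝ => e) (M.noise (δ i) : Measure ℝ) := fun i =>
    variance_nonneg _ _
  have := Finset.sum_nonneg (s := Finset.univ) (fun i _ => mul_nonneg (sq_nonneg (w i))
    (div_nonneg (this i) (sq_nonneg (δ i ^ q₂))))
  positivity

lemma SimOutput.isProbabilityMeasure_law (M : SimOutput) (q₂ δ : ℝ) :
    IsProbabilityMeasure (M.law q₂ δ) :=
  Measure.isProbabilityMeasure_map (by fun_prop)

lemma SimOutput.memLp_law (M : SimOutput) (q₂ δ : ℝ)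
    (h : MemLp (fun e : ℝ => e) 2 (M.noise δ : Measure ℝ)) :
    MemLp (fun x : ℝ => x) 2 (M.law q₂ δ) := by
  unfold SimOutput.law
  rw [memLp_map_measure_iff (by fun_prop) (by fun_prop)]
  have := (memLp_const (M.θ + M.bias δ)).add (h.const_mul (1 / δ ^ q₂))
  convert! this using 1
  ext e
  simp [div_eq_inv_mul]

lemma SimOutput.integral_law (M : SimOutput) (q₂ δ : ℝ)
    (h : MemLp (fun e : ℝ => e) 2 (M.noise δ : Measure ℝ))
    (h0 : ∫ e, e ∂(M.noise δ : Measure ℝ) = 0) :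
    ∫ x, x ∂(M.law q₂ δ) = M.θ + M.bias δ := by
  unfold SimOutput.law
  rw [integral_map (by fun_prop) (by fun_prop), integral_add (integrable_const _)
    ((h.integrable (by norm_num)).div_const _), integral_div, h0]
  simp

lemma SimOutput.variance_law (M : SimOutput) (q₂ δ : ℝ) :
    variance (fun x : ℝ => x) (M.law q₂ δ) =
      variance (fun e : ℝ => e) (M.noise δ : Measure ℝ) / (δ ^ q₂) ^ 2 := by
  unfold SimOutput.law
  rw [variance_map (by fun_prop) (by fun_prop)]
  have : (fun x : ℝ => x) ∘ (fun e : ℝ => M.θ + M.bias δ + e / δ ^ q₂) =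
      fun e => (M.θ + M.bias δ) + (1 / δ ^ q₂) * e := by
    ext e; simp [div_eq_inv_mul]
  rw [this, variance_const_add (by fun_prop), variance_const_mul]
  ring

lemma weightedMSE_eq (M : SimOutput) (q₂ : ℝ) {n : ℕ} (δ w : Fin n → ℝ)
    (h : ∀ i, MemLp (fun e : ℝ => e) 2 (M.noise (δ i) : Measure ℝ))
    (h0 : ∀ i, ∫ e, e ∂(M.noise (δ i) : Measure ℝ) = 0) :
    weightedMSE M q₂ δ w = ENNReal.ofReal (biasVarianceMSE M q₂ δ w) := by
  have hP : ∀ i, IsProbabilityMeasure (M.law q₂ (δ i)) := fun i => M.isProbabilityMeasure_law q₂ _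
  set μ := Measure.pi fun i => M.law q₂ (δ i) with hμ
  have hL : ∀ i, MemLp (fun x : ℝ => w i * x) 2 (M.law q₂ (δ i)) := fun i =>
    (M.memLp_law q₂ (δ i) (h i)).const_mul _
  have hLp : ∀ i, MemLp (fun x : Fin n → ℝ => w i * x i) 2 μ := fun i =>
    (hL i).comp_measurePreserving (measurePreserving_eval _ i)
  have hS : MemLp (fun x : Fin n → ℝ => ∑ i, w i * x i) 2 μ := memLp_finsetSum _ fun i _ => hLp i
  have hX : MemLp (fun x : Fin n → ℝ => ∑ i, w i * x i - M.θ) 2 μ := hS.sub (memLp_const _)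
  have hint : ∀ i, ∫ x : Fin n → ℝ, w i * x i ∂μ = w i * (M.θ + M.bias (δ i)) := by
    intro i
    rw [← M.integral_law q₂ (δ i) (h i) (h0 i), integral_const_mul]
    congr 1
    exact integral_comp_eval (μ := fun i => M.law q₂ (δ i)) (i := i) (f := fun x : ℝ => x)
      (by fun_prop)
  have hmean : ∫ x : Fin n → ℝ, (∑ i, w i * x i - M.θ) ∂μ =
      M.θ * (∑ i, w i - 1) + ∑ i, w i * M.bias (δ i) := by
    rw [integral_sub (hS.integrable (by norm_num)) (integrable_const _),
      integral_finsetSum _ fun i _ => (hLp i).integrable (by norm_num)]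
    simp_rw [hint, mul_add, Finset.sum_add_distrib, ← Finset.sum_mul]
    simp
    ring
  have hvar : variance (fun x : Fin n → ℝ => ∑ i, w i * x i - M.θ) μ =
      ∑ i, w i ^ 2 * (variance (fun e : ℝ => e) (M.noise (δ i) : Measure ℝ) /
        (δ i ^ q₂) ^ 2) := by
    rw [variance_sub_const hS.aestronglyMeasurable]
    refine Eq.trans ?_ ((variance_sum_pi hL).trans (Finset.sum_congr rfl fun i _ =>
      (variance_const_mul _ _ _).trans (by rw [M.variance_law])))
    congr 1
    ext x
    simp
  unfold weightedMSE biasVarianceMSE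
  rw [← ofReal_integral_eq_lintegral_ofReal hX.integrable_sq (ae_of_all _ fun x => sq_nonneg _)]
  have hv := variance_eq_sub hX
  rw [← hvar, ← hmean]
  simp only [Pi.pow_apply] at hv
  congr 1
  linarith

/-! ### Growth of the sums φ and weighted Cesàro averages. -/

lemma phiSum_eq_sum_range (n₀ n : ℕ) (κ : ℝ) :
    phiSum n₀ n κ = ∑ i ∈ Finset.range n, 1 / (((i : ℝ) + 1) + n₀) ^ κ :=
  Fin.sum_univ_eq_sum_range (fun i : ℕ => 1 / (((i : ℝ) + 1) + n₀) ^ κ) n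

/-- Bernoulli's inequality for the exponent s ≤ 1, applied to (1 + 1/m)^s. This and its backward
companion replace the comparison of φ with an integral. -/
lemma rpow_succ_sub_le {m s : ℝ} (hm : 0 < m) (hs : 0 ≤ s) (hs1 : s ≤ 1) :
    (m + 1) ^ s - m ^ s ≤ s * (1 / m ^ (1 - s)) := by
  have h1 : (m + 1) = m * (1 + 1 / m) := by field_simp
  have hi : 0 < 1 / m := by positivity
  have h2 := rpow_one_add_le_one_add_mul_self (s := 1 / m) (by linarith) hs hs1
  rw [h1, Real.mul_rpow hm.le (by positivity), Real.rpow_sub hm, Real.rpow_one]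
  have h3 := mul_le_mul_of_nonneg_left h2 (Real.rpow_nonneg hm.le s)
  have h4 : s * (1 / (m / m ^ s)) = m ^ s * (s * (1 / m)) := by
    have := Real.rpow_pos_of_pos hm s
    field_simp
  rw [h4]
  linarith

lemma le_rpow_sub_rpow_pred {m s : ℝ} (hm : 1 ≤ m) (hs : 0 ≤ s) (hs1 : s ≤ 1) :
    s * (1 / m ^ (1 - s)) ≤ m ^ s - (m - 1) ^ s := by
  have hm0 : 0 < m := by linarith
  have h1 : (m - 1) = m * (1 + -(1 / m)) := by field_simp; ring
  have hi : 1 / m ≤ 1 := by rw [div_le_one hm0]; exact hm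
  have h2 := rpow_one_add_le_one_add_mul_self (s := -(1 / m)) (by linarith) hs hs1
  rw [h1, Real.mul_rpow hm0.le (by linarith), Real.rpow_sub hm0, Real.rpow_one]
  have h3 := mul_le_mul_of_nonneg_left h2 (Real.rpow_nonneg hm0.le s)
  have h4 : s * (1 / (m / m ^ s)) = m ^ s * (s * (1 / m)) := by
    have := Real.rpow_pos_of_pos hm0 s
    field_simp
  rw [h4]
  linarith

lemma le_mul_phiSum (n₀ n : ℕ) {s : ℝ} (hs : 0 ≤ s) (hs1 : s ≤ 1) :
    ((n : ℝ) + 1 + n₀) ^ s - (1 + n₀ : ℝ) ^ s ≤ s * phiSum n₀ n (1 - s) := by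
  rw [phiSum_eq_sum_range]
  induction n with
  | zero => simp
  | succ n ih =>
    rw [Finset.sum_range_succ, mul_add]
    have := rpow_succ_sub_le (m := (n : ℝ) + 1 + n₀) (by positivity) hs hs1
    have e : ((n + 1 : ℕ) : ℝ) + 1 + n₀ = (n : ℝ) + 1 + n₀ + 1 := by push_cast; ring
    rw [e]
    linarith

lemma mul_phiSum_le (n₀ n : ℕ) {s : ℝ} (hs : 0 ≤ s) (hs1 : s ≤ 1) :
    s * phiSum n₀ n (1 - s) ≤ ((n : ℝ) + n₀) ^ s - (n₀ : ℝ) ^ s := by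
  rw [phiSum_eq_sum_range]
  induction n with
  | zero => simp
  | succ n ih =>
    rw [Finset.sum_range_succ, mul_add]
    -- For n₀ = 0 the first term has m = 1, so the telescoping starts at 0 ^ s; hence the backward
    -- inequality is needed for m ≥ 1 and not only for m > 1.
    have := le_rpow_sub_rpow_pred (m := (n : ℝ) + 1 + n₀)
      (by have : (0 : ℝ) ≤ n := by positivity
          have : (0 : ℝ) ≤ n₀ := by positivity
          linarith) hs hs1
    have e : ((n + 1 : ℕ) : ℝ) + n₀ = (n : ℝ) + 1 + n₀ := by push_cast; ring
    have e' : (n : ℝ) + 1 + n₀ - 1 = n + n₀ := by ring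
    rw [e]
    rw [e'] at this
    linarith

lemma tendsto_natCast_add_atTop (n₀ : ℕ) :
    Tendsto (fun n : ℕ => (n : ℝ) + n₀) atTop atTop :=
  tendsto_atTop_add_const_right _ _ tendsto_natCast_atTop_atTop

lemma tendsto_phiSum_div_rpow (n₀ : ℕ) {s : ℝ} (hs : 0 < s) (hs1 : s ≤ 1) :
    Tendsto (fun n : ℕ => phiSum n₀ n (1 - s) / ((n : ℝ) + n₀) ^ s) atTop (𝓝 (1 / s)) := by
  have hT : Tendsto (fun n : ℕ => ((n : ℝ) + n₀) ^ s) atTop atTop :=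
    (tendsto_rpow_atTop hs).comp (tendsto_natCast_add_atTop n₀)
  have hlow : Tendsto (fun n : ℕ => (1 - (1 + n₀ : ℝ) ^ s / ((n : ℝ) + n₀) ^ s) * (1 / s)) atTop
      (𝓝 (1 / s)) := by
    have := ((tendsto_const_nhds (x := (1 : ℝ))).sub
      ((tendsto_const_nhds (x := (1 + n₀ : ℝ) ^ s)).div_atTop hT)).mul_const (1 / s)
    simpa using this
  refine tendsto_of_tendsto_of_tendsto_of_le_of_le' hlow tendsto_const_nhds ?_ ?_
  · filter_upwards [hT.eventually_gt_atTop 0] with n hn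
    have h1 := le_mul_phiSum n₀ n hs.le hs1
    have h2 : ((n : ℝ) + n₀) ^ s ≤ ((n : ℝ) + 1 + n₀) ^ s :=
      Real.rpow_le_rpow (by positivity) (by linarith) hs.le
    rw [le_div_iff₀ hn]
    have : (1 - (1 + n₀ : ℝ) ^ s / ((n : ℝ) + n₀) ^ s) * (1 / s) * ((n : ℝ) + n₀) ^ s =
      (((n : ℝ) + n₀) ^ s - (1 + n₀ : ℝ) ^ s) / s := by field_simp
    rw [this, div_le_iff₀ hs]
    linarith
  · filter_upwards [hT.eventually_gt_atTop 0] with n hn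
    have h1 := mul_phiSum_le n₀ n hs.le hs1
    have h2 : 0 ≤ (n₀ : ℝ) ^ s := by positivity
    rw [div_le_div_iff₀ hn hs]
    linarith

lemma tendsto_phiSum_one (n₀ : ℕ) : Tendsto (fun n : ℕ => phiSum n₀ n 1) atTop atTop := by
  have h := tendsto_atTop_add_const_right atTop (-∑ i ∈ Finset.range n₀, 1 / ((i : ℝ) + 1))
    (Real.tendsto_sum_range_one_div_nat_succ_atTop.comp (tendsto_add_atTop_nat n₀))
  refine h.congr fun n => ?_
  rw [phiSum_eq_sum_range]
  simp only [Function.comp, add_comm n n₀, Finset.sum_range_add, Real.rpow_one]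
  have : ∀ i : ℕ, (1 : ℝ) / (((n₀ + i : ℕ) : ℝ) + 1) = 1 / ((i : ℝ) + 1 + n₀) := by
    intro i; push_cast; congr 1; ring
  simp only [this]
  ring

lemma tendsto_phiSum (n₀ : ℕ) {s : ℝ} (hs : 0 < s) (hs1 : s ≤ 1) :
    Tendsto (fun n : ℕ => phiSum n₀ n (1 - s)) atTop atTop := by
  have hT : Tendsto (fun n : ℕ => ((n : ℝ) + n₀) ^ s) atTop atTop :=
    (tendsto_rpow_atTop hs).comp (tendsto_natCast_add_atTop n₀)
  refine ((tendsto_phiSum_div_rpow n₀ hs hs1).pos_mul_atTop (by positivity) hT).congr' ?_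
  filter_upwards [hT.eventually_gt_atTop 0] with n hn
  field_simp

/-- Weighted Cesàro averages with weights `1 / (j + n₀) ^ κ` converge to the limit of the
sequence. -/
lemma tendsto_sum_div_phiSum (n₀ : ℕ) {κ : ℝ}
    (hκ : Tendsto (fun n : ℕ => phiSum n₀ n κ) atTop atTop) {c : ℕ → ℝ} {l : ℝ}
    (hc : Tendsto c atTop (𝓝 l)) :
    Tendsto (fun n : ℕ => (∑ i : Fin n, c i * (1 / (((i : ℝ) + 1) + n₀) ^ κ)) / phiSum n₀ n κ)
      atTop (𝓝 l) := by
  set g : ℕ → ℝ := fun i => 1 / (((i : ℝ) + 1) + n₀) ^ κ with hg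
  have hg0 : 0 ≤ g := fun i => by simp only [hg, Pi.zero_apply]; positivity
  have ho : (fun i => (c i - l) * g i) =o[atTop] g := by
    have : (fun i => c i - l) =o[atTop] (fun _ : ℕ => (1 : ℝ)) := by
      rw [isLittleO_one_iff]
      simpa using hc.sub_const l
    simpa using this.mul_isBigO (isBigO_refl g atTop)
  have hsum : (fun n : ℕ => ∑ i ∈ Finset.range n, g i) = fun n => phiSum n₀ n κ := by
    ext n; rw [phiSum_eq_sum_range]
  -- Divergence of φ lets a termwise little-o pass to the partial sums.
  have h1 := ho.sum_range hg0 (by rw [hsum]; exact hκ)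
  rw [hsum] at h1
  have h2 := h1.tendsto_div_nhds_zero.add_const l
  rw [zero_add] at h2
  refine h2.congr' ?_
  filter_upwards [hκ.eventually_gt_atTop 0] with n hn
  have h3 : ∑ i : Fin n, c i * (1 / (((i : ℝ) + 1) + n₀) ^ κ) = ∑ i ∈ Finset.range n, c i * g i :=
    Fin.sum_univ_eq_sum_range (fun i : ℕ => c i * g i) n
  rw [h3]
  simp_rw [sub_mul, Finset.sum_sub_distrib, ← Finset.mul_sum]
  rw [congrFun hsum n]
  field_simp
  ring

/-! ### Exponents and the scale T. -/

/-- The rate `q₁ / (2 (q₁ + q₂))` at which the root mean squared error decays. -/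
noncomputable def rmseExp (q₁ q₂ : ℝ) : ℝ := q₁ / (2 * (q₁ + q₂))

lemma rmseExp_pos {q₁ q₂ : ℝ} (hq₁ : 0 < q₁) (hq₂ : 0 < q₂) : 0 < rmseExp q₁ q₂ := by
  unfold rmseExp; positivity

lemma two_mul_rmseExp_lt_one {q₁ q₂ : ℝ} (hq₁ : 0 < q₁) (hq₂ : 0 < q₂) :
    2 * rmseExp q₁ q₂ < 1 := by
  unfold rmseExp
  rw [← mul_div_assoc, div_lt_one (by positivity)]
  linarith

lemma two_mul_rmseExp {q₁ q₂ : ℝ} (hq₁ : 0 < q₁) (hq₂ : 0 < q₂) :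
    2 * rmseExp q₁ q₂ = q₁ / (q₁ + q₂) := by
  unfold rmseExp
  field_simp

lemma one_sub_rmseExp {q₁ q₂ : ℝ} (hq₁ : 0 < q₁) (hq₂ : 0 < q₂) :
    (q₁ + 2 * q₂) / (2 * (q₁ + q₂)) = 1 - rmseExp q₁ q₂ := by
  unfold rmseExp
  field_simp
  ring

lemma one_sub_two_mul_rmseExp {q₁ q₂ : ℝ} (hq₁ : 0 < q₁) (hq₂ : 0 < q₂) :
    q₂ / (q₁ + q₂) = 1 - 2 * rmseExp q₁ q₂ := by
  unfold rmseExp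
  field_simp
  ring

lemma rateExp_mul_left {q₁ q₂ : ℝ} (hq₁ : 0 < q₁) (hq₂ : 0 < q₂) :
    rateExp q₁ q₂ * q₁ = rmseExp q₁ q₂ := by
  unfold rmseExp rateExp
  field_simp

lemma rateExp_mul_right {q₁ q₂ : ℝ} (hq₁ : 0 < q₁) (hq₂ : 0 < q₂) :
    rateExp q₁ q₂ * q₂ = 1 / 2 - rmseExp q₁ q₂ := by
  unfold rmseExp rateExp
  field_simp
  ring

/-- The scale `(n + n₀) ^ β`, `β` being the decay rate of the root mean squared error. -/
noncomputable def rmseScale (q₁ q₂ : ℝ) (n₀ n : ℕ) : ℝ := ((n : ℝ) + n₀) ^ rmseExp q₁ q₂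

lemma tendsto_rmseScale {q₁ q₂ : ℝ} (hq₁ : 0 < q₁) (hq₂ : 0 < q₂) (n₀ : ℕ) :
    Tendsto (rmseScale q₁ q₂ n₀) atTop atTop :=
  (tendsto_rpow_atTop (rmseExp_pos hq₁ hq₂)).comp (tendsto_natCast_add_atTop n₀)

lemma rmseScale_sq (q₁ q₂ : ℝ) (n₀ n : ℕ) :
    rmseScale q₁ q₂ n₀ n ^ 2 = ((n : ℝ) + n₀) ^ (2 * rmseExp q₁ q₂) := by
  unfold rmseScale
  rw [← Real.rpow_natCast, ← Real.rpow_mul (by positivity), mul_comm]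
  norm_num

lemma tendsto_phiSum_bias {q₁ q₂ : ℝ} (hq₁ : 0 < q₁) (hq₂ : 0 < q₂) (n₀ : ℕ) :
    Tendsto (fun n => phiSum n₀ n (1 - rmseExp q₁ q₂) / rmseScale q₁ q₂ n₀ n) atTop
      (𝓝 (1 / rmseExp q₁ q₂)) :=
  tendsto_phiSum_div_rpow n₀ (rmseExp_pos hq₁ hq₂)
    (by linarith [rmseExp_pos hq₁ hq₂, two_mul_rmseExp_lt_one hq₁ hq₂])

lemma tendsto_phiSum_variance {q₁ q₂ : ℝ} (hq₁ : 0 < q₁) (hq₂ : 0 < q₂) (n₀ : ℕ) :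
    Tendsto (fun n => phiSum n₀ n (1 - 2 * rmseExp q₁ q₂) / rmseScale q₁ q₂ n₀ n ^ 2) atTop
      (𝓝 (1 / (2 * rmseExp q₁ q₂))) := by
  simp_rw [rmseScale_sq]
  exact tendsto_phiSum_div_rpow n₀ (by linarith [rmseExp_pos hq₁ hq₂])
    (two_mul_rmseExp_lt_one hq₁ hq₂).le

/-! ### Asymptotics of the matrix ξ. -/

/-- The determinant of the Gram matrix inverted in `xiMatrix`. -/
noncomputable def gramDet (q₁ q₂ : ℝ) (n₀ n : ℕ) : ℝ :=
  phiSum n₀ n 1 * phiSum n₀ n (1 - 2 * rmseExp q₁ q₂) - phiSum n₀ n (1 - rmseExp q₁ q₂) ^ 2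

lemma xiMatrix_eq {q₁ q₂ : ℝ} (hq₁ : 0 < q₁) (hq₂ : 0 < q₂) (n₀ n : ℕ) :
    xiMatrix q₁ q₂ n₀ n =
      !![phiSum n₀ n (1 - 2 * rmseExp q₁ q₂) / gramDet q₁ q₂ n₀ n,
          -phiSum n₀ n (1 - rmseExp q₁ q₂) / gramDet q₁ q₂ n₀ n;
        -phiSum n₀ n (1 - rmseExp q₁ q₂) / gramDet q₁ q₂ n₀ n,
          phiSum n₀ n 1 / gramDet q₁ q₂ n₀ n] := by
  unfold xiMatrix
  rw [Matrix.inv_def, Matrix.adjugate_fin_two_of, Matrix.det_fin_two_of, Ring.inverse_eq_inv',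
    one_sub_rmseExp hq₁ hq₂, one_sub_two_mul_rmseExp hq₁ hq₂, ← sq]
  change (gramDet q₁ q₂ n₀ n)⁻¹ • _ = _
  ext i j
  fin_cases i <;> fin_cases j <;> simp [div_eq_inv_mul]

/-- The product φ(1)φ(1-2β) dominates: φ(1-β)² is only of order T², without the divergent factor
φ(1). -/
lemma tendsto_gramDet {q₁ q₂ : ℝ} (hq₁ : 0 < q₁) (hq₂ : 0 < q₂) (n₀ : ℕ) :
    Tendsto (fun n => gramDet q₁ q₂ n₀ n / (phiSum n₀ n 1 * rmseScale q₁ q₂ n₀ n ^ 2)) atTop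
      (𝓝 (1 / (2 * rmseExp q₁ q₂))) := by
  have h := (tendsto_phiSum_variance hq₁ hq₂ n₀).sub
    (((tendsto_phiSum_bias hq₁ hq₂ n₀).pow 2).div_atTop (tendsto_phiSum_one n₀))
  rw [sub_zero] at h
  refine h.congr' ?_
  filter_upwards [(tendsto_phiSum_one n₀).eventually_gt_atTop 0,
    (tendsto_rmseScale hq₁ hq₂ n₀).eventually_gt_atTop 0] with n h1 h2
  unfold gramDet
  field_simp

lemma eventually_gramDet_pos {q₁ q₂ : ℝ} (hq₁ : 0 < q₁) (hq₂ : 0 < q₂) (n₀ : ℕ) :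
    ∀ᶠ n in atTop, 0 < gramDet q₁ q₂ n₀ n := by
  have hβ := rmseExp_pos hq₁ hq₂
  filter_upwards [(tendsto_phiSum_one n₀).eventually_gt_atTop 0,
    (tendsto_rmseScale hq₁ hq₂ n₀).eventually_gt_atTop 0,
    (tendsto_gramDet hq₁ hq₂ n₀).eventually_const_lt (u := 0) (by positivity)] with n h1 h2 h3
  exact (div_pos_iff_of_pos_right (by positivity)).1 h3

lemma tendsto_mul_xiMatrix_zero_zero {q₁ q₂ : ℝ} (hq₁ : 0 < q₁) (hq₂ : 0 < q₂) (n₀ : ℕ) :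
    Tendsto (fun n => phiSum n₀ n 1 * xiMatrix q₁ q₂ n₀ n 0 0) atTop (𝓝 1) := by
  have hβ := rmseExp_pos hq₁ hq₂
  have h := (tendsto_phiSum_variance hq₁ hq₂ n₀).div (tendsto_gramDet hq₁ hq₂ n₀)
    (by positivity)
  rw [div_self (by positivity)] at h
  refine h.congr' ?_
  filter_upwards [(tendsto_phiSum_one n₀).eventually_gt_atTop 0,
    (tendsto_rmseScale hq₁ hq₂ n₀).eventually_gt_atTop 0,
    eventually_gramDet_pos hq₁ hq₂ n₀] with n h1 h2 h3
  simp only [xiMatrix_eq hq₁ hq₂, Matrix.of_apply, Matrix.cons_val', Matrix.cons_val_zero,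
    Matrix.cons_val_fin_one, Pi.div_apply]
  field_simp

/-- The constant -2 matters: in `tendsto_twoDecay` it cancels the bias contributed by the second
decay. -/
lemma tendsto_mul_xiMatrix_zero_one {q₁ q₂ : ℝ} (hq₁ : 0 < q₁) (hq₂ : 0 < q₂) (n₀ : ℕ) :
    Tendsto (fun n => phiSum n₀ n 1 * (rmseScale q₁ q₂ n₀ n * xiMatrix q₁ q₂ n₀ n 0 1)) atTop
      (𝓝 (-2)) := by
  have hβ := rmseExp_pos hq₁ hq₂
  have h := ((tendsto_phiSum_bias hq₁ hq₂ n₀).div (tendsto_gramDet hq₁ hq₂ n₀)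
    (by positivity)).neg
  have e : -(1 / rmseExp q₁ q₂ / (1 / (2 * rmseExp q₁ q₂))) = -2 := by field_simp
  rw [e] at h
  refine h.congr' ?_
  filter_upwards [(tendsto_phiSum_one n₀).eventually_gt_atTop 0,
    (tendsto_rmseScale hq₁ hq₂ n₀).eventually_gt_atTop 0,
    eventually_gramDet_pos hq₁ hq₂ n₀] with n h1 h2 h3
  simp only [xiMatrix_eq hq₁ hq₂, Matrix.of_apply, Matrix.cons_val', Matrix.cons_val_zero,
    Matrix.cons_val_fin_one, Matrix.cons_val_one, Pi.div_apply]
  field_simp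

lemma xiMatrix_one_zero {q₁ q₂ : ℝ} (hq₁ : 0 < q₁) (hq₂ : 0 < q₂) (n₀ n : ℕ) :
    xiMatrix q₁ q₂ n₀ n 1 0 = xiMatrix q₁ q₂ n₀ n 0 1 := by
  simp [xiMatrix_eq hq₁ hq₂]

lemma tendsto_mul_xiMatrix_one_one {q₁ q₂ : ℝ} (hq₁ : 0 < q₁) (hq₂ : 0 < q₂) (n₀ : ℕ) :
    Tendsto (fun n => rmseScale q₁ q₂ n₀ n ^ 2 * xiMatrix q₁ q₂ n₀ n 1 1) atTop
      (𝓝 (2 * rmseExp q₁ q₂)) := by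
  have hβ := rmseExp_pos hq₁ hq₂
  have h := (tendsto_gramDet hq₁ hq₂ n₀).inv₀ (by positivity)
  rw [one_div, inv_inv] at h
  refine h.congr' ?_
  filter_upwards [(tendsto_phiSum_one n₀).eventually_gt_atTop 0,
    (tendsto_rmseScale hq₁ hq₂ n₀).eventually_gt_atTop 0,
    eventually_gramDet_pos hq₁ hq₂ n₀] with n h1 h2 h3
  simp only [xiMatrix_eq hq₁ hq₂, Matrix.of_apply, Matrix.cons_val',
    Matrix.cons_val_fin_one, Matrix.cons_val_one]
  field_simp

lemma tendsto_xiMatrix_zero_zero {q₁ q₂ : ℝ} (hq₁ : 0 < q₁) (hq₂ : 0 < q₂) (n₀ : ℕ) :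
    Tendsto (fun n => xiMatrix q₁ q₂ n₀ n 0 0) atTop (𝓝 0) := by
  refine ((tendsto_mul_xiMatrix_zero_zero hq₁ hq₂ n₀).div_atTop (tendsto_phiSum_one n₀)).congr' ?_
  filter_upwards [(tendsto_phiSum_one n₀).eventually_gt_atTop 0] with n h1
  field_simp

lemma tendsto_xiMatrix_zero_one {q₁ q₂ : ℝ} (hq₁ : 0 < q₁) (hq₂ : 0 < q₂) (n₀ : ℕ) :
    Tendsto (fun n => rmseScale q₁ q₂ n₀ n * xiMatrix q₁ q₂ n₀ n 0 1) atTop (𝓝 0) := by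
  refine ((tendsto_mul_xiMatrix_zero_one hq₁ hq₂ n₀).div_atTop (tendsto_phiSum_one n₀)).congr' ?_
  filter_upwards [(tendsto_phiSum_one n₀).eventually_gt_atTop 0] with n h1
  field_simp

/-! ### The noise factor and the optimal bias factor. -/

/-- The least noise factor `∑ j, w j ^ 2 (j + n₀) ^ (1 - 2 β)` of weights that sum to one and have
bias factor `a`. -/
noncomputable def noiseFactor (q₁ q₂ : ℝ) (n₀ n : ℕ) (a : ℝ) : ℝ :=
  xiMatrix q₁ q₂ n₀ n 0 0 * a ^ 2 + 2 * xiMatrix q₁ q₂ n₀ n 0 1 * a + xiMatrix q₁ q₂ n₀ n 1 1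

lemma mem_feasibleSet {q₁ q₂ K : ℝ} {n₀ n : ℕ} {a : ℝ} :
    a ∈ feasibleSet q₁ q₂ K n₀ n ↔ noiseFactor q₁ q₂ n₀ n a ≤ K ^ (2 * (q₁ + q₂)) * a ^ 2 := by
  simp only [feasibleSet, noiseFactor, Set.mem_ofPred_eq]
  constructor <;> intro h <;> linarith

lemma objective_eq {q₁ q₂ : ℝ} (hq₁ : 0 < q₁) (hq₂ : 0 < q₂) (n₀ n : ℕ) (a : ℝ) :
    objective q₁ q₂ n₀ n a = |a| ^ (2 * (1 - 2 * rmseExp q₁ q₂)) *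
      noiseFactor q₁ q₂ n₀ n a ^ (2 * rmseExp q₁ q₂) := by
  rw [objective, noiseFactor, mul_div_assoc, one_sub_two_mul_rmseExp hq₁ hq₂,
    two_mul_rmseExp hq₁ hq₂]

lemma continuous_noiseFactor (q₁ q₂ : ℝ) (n₀ n : ℕ) : Continuous (noiseFactor q₁ q₂ n₀ n) := by
  unfold noiseFactor
  fun_prop

lemma phiSum_pos (n₀ : ℕ) {n : ℕ} (hn : 0 < n) (κ : ℝ) : 0 < phiSum n₀ n κ :=
  Finset.sum_pos (fun i _ => by positivity) ⟨⟨0, hn⟩, Finset.mem_univ _⟩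

/-- Completing the square in a; the left side is the least noise when only the sum of the weights is
prescribed. -/
lemma inv_phiSum_le_noiseFactor {q₁ q₂ : ℝ} (hq₁ : 0 < q₁) (hq₂ : 0 < q₂) {n₀ n : ℕ}
    (hn : 0 < n) (h : 0 < gramDet q₁ q₂ n₀ n) (a : ℝ) :
    (phiSum n₀ n (1 - 2 * rmseExp q₁ q₂))⁻¹ ≤ noiseFactor q₁ q₂ n₀ n a := by
  have hQ := phiSum_pos n₀ hn (1 - 2 * rmseExp q₁ q₂)
  simp only [noiseFactor, xiMatrix_eq hq₁ hq₂, Matrix.of_apply, Matrix.cons_val',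
    Matrix.cons_val_zero, Matrix.cons_val_fin_one, Matrix.cons_val_one]
  have hD : gramDet q₁ q₂ n₀ n = phiSum n₀ n 1 * phiSum n₀ n (1 - 2 * rmseExp q₁ q₂) -
    phiSum n₀ n (1 - rmseExp q₁ q₂) ^ 2 := rfl
  set Q := phiSum n₀ n (1 - 2 * rmseExp q₁ q₂)
  set P := phiSum n₀ n (1 - rmseExp q₁ q₂)
  set D := gramDet q₁ q₂ n₀ n
  have : Q / D * a ^ 2 + 2 * (-P / D) * a + phiSum n₀ n 1 / D - Q⁻¹ = (Q * a - P) ^ 2 / (Q * D) := by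
    field_simp
    rw [hD]
    ring
  have : 0 ≤ (Q * a - P) ^ 2 / (Q * D) := by positivity
  linarith

lemma tendsto_noiseFactor {q₁ q₂ : ℝ} (hq₁ : 0 < q₁) (hq₂ : 0 < q₂) (n₀ : ℕ) (u : ℝ) :
    Tendsto (fun n => rmseScale q₁ q₂ n₀ n ^ 2 *
      noiseFactor q₁ q₂ n₀ n (u / rmseScale q₁ q₂ n₀ n)) atTop (𝓝 (2 * rmseExp q₁ q₂)) := by
  have h := (((tendsto_xiMatrix_zero_zero hq₁ hq₂ n₀).mul_const (u ^ 2)).add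
    ((tendsto_xiMatrix_zero_one hq₁ hq₂ n₀).mul_const (2 * u))).add
    (tendsto_mul_xiMatrix_one_one hq₁ hq₂ n₀)
  simp only [zero_mul, zero_add] at h
  refine h.congr' ?_
  filter_upwards [(tendsto_rmseScale hq₁ hq₂ n₀).eventually_gt_atTop 0] with n h2
  unfold noiseFactor
  field_simp

/-- After multiplication by T², feasibility of u/T reads 2β + o(1) ≤ K^(2(q₁+q₂))u². -/
lemma eventually_mem_feasibleSet {q₁ q₂ K : ℝ} (hq₁ : 0 < q₁) (hq₂ : 0 < q₂) (n₀ : ℕ) {u : ℝ}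
    (hu : 2 * rmseExp q₁ q₂ < K ^ (2 * (q₁ + q₂)) * u ^ 2) :
    ∀ᶠ n in atTop, u / rmseScale q₁ q₂ n₀ n ∈ feasibleSet q₁ q₂ K n₀ n := by
  filter_upwards [(tendsto_noiseFactor hq₁ hq₂ n₀ u).eventually_lt_const hu,
    (tendsto_rmseScale hq₁ hq₂ n₀).eventually_gt_atTop 0] with n h1 h2
  rw [mem_feasibleSet, div_pow, ← mul_div_assoc, le_div_iff₀ (by positivity)]
  linarith

/-- The feasible set is closed and unbounded in general, so compactness comes from coercivity: the
noise factor is bounded away from 0 and the power of |a| diverges. -/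
lemma exists_isMinOn_objective {q₁ q₂ K : ℝ} (hq₁ : 0 < q₁) (hq₂ : 0 < q₂) {n₀ n : ℕ}
    (hn : 0 < n) (h : 0 < gramDet q₁ q₂ n₀ n) (hne : (feasibleSet q₁ q₂ K n₀ n).Nonempty) :
    ∃ a ∈ feasibleSet q₁ q₂ K n₀ n,
      IsMinOn (objective q₁ q₂ n₀ n) (feasibleSet q₁ q₂ K n₀ n) a := by
  have hβ := rmseExp_pos hq₁ hq₂
  have hγ := two_mul_rmseExp_lt_one hq₁ hq₂
  obtain ⟨a₀, ha₀⟩ := hne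
  have hclosed : IsClosed (feasibleSet q₁ q₂ K n₀ n) := by
    have : feasibleSet q₁ q₂ K n₀ n =
        {a | noiseFactor q₁ q₂ n₀ n a ≤ K ^ (2 * (q₁ + q₂)) * a ^ 2} := by
      ext a; exact mem_feasibleSet
    rw [this]
    exact isClosed_le (continuous_noiseFactor _ _ _ _) (by fun_prop)
  have hobj : objective q₁ q₂ n₀ n = fun a => |a| ^ (2 * (1 - 2 * rmseExp q₁ q₂)) *
      noiseFactor q₁ q₂ n₀ n a ^ (2 * rmseExp q₁ q₂) := funext (objective_eq hq₁ hq₂ n₀ n)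
  have hcont : Continuous (objective q₁ q₂ n₀ n) := by
    rw [hobj]
    exact (continuous_abs.rpow_const fun _ => Or.inr (by linarith)).mul
      ((continuous_noiseFactor _ _ _ _).rpow_const fun _ => Or.inr (by linarith))
  have hQ := phiSum_pos n₀ hn (1 - 2 * rmseExp q₁ q₂)
  have hcoer : Tendsto (objective q₁ q₂ n₀ n) (cocompact ℝ) atTop := by
    have h1 : Tendsto (fun a : ℝ => |a| ^ (2 * (1 - 2 * rmseExp q₁ q₂))) (cocompact ℝ) atTop :=
      (tendsto_rpow_atTop (by linarith)).comp tendsto_norm_cocompact_atTop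
    refine tendsto_atTop_mono (fun a => ?_) (h1.atTop_mul_const
      (Real.rpow_pos_of_pos (inv_pos.2 hQ) (2 * rmseExp q₁ q₂)))
    rw [objective_eq hq₁ hq₂]
    gcongr
    exact inv_phiSum_le_noiseFactor hq₁ hq₂ hn h a
  exact hcont.continuousOn.exists_isMinOn' hclosed ha₀
    ((hcoer.eventually_ge_atTop _).filter_mono inf_le_left)

lemma exists_isTwoDecayArray {q₁ q₂ K : ℝ} (hq₁ : 0 < q₁) (hq₂ : 0 < q₂) (hK : 0 < K) (n₀ : ℕ) :
    ∃ W : WeightArray, IsTwoDecayArray q₁ q₂ K n₀ W := by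
  have hβ := rmseExp_pos hq₁ hq₂
  have hκ : 0 < K ^ (2 * (q₁ + q₂)) := by positivity
  -- Any u with K^(2(q₁+q₂))u² > 2β gives eventual feasibility; this one makes the left product 2β +
  -- 1.
  have hu : 2 * rmseExp q₁ q₂ < K ^ (2 * (q₁ + q₂)) *
      √((2 * rmseExp q₁ q₂ + 1) / K ^ (2 * (q₁ + q₂))) ^ 2 := by
    rw [Real.sq_sqrt (by positivity)]
    field_simp
    linarith
  have : ∀ᶠ n in atTop, ∃ w : Fin n → ℝ, IsTwoDecay q₁ q₂ K n₀ w := by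
    filter_upwards [eventually_mem_feasibleSet hq₁ hq₂ n₀ hu, eventually_gt_atTop 0,
      eventually_gramDet_pos hq₁ hq₂ n₀] with n h1 h2 h3
    obtain ⟨a, ha, hmin⟩ := exists_isMinOn_objective hq₁ hq₂ h2 h3 ⟨_, h1⟩
    exact ⟨_, a, ha, hmin, fun i => rfl⟩
  exact Filter.skolem.1 this

/-- Feasibility bounds |T a| from below and optimality against a competitor u/T bounds it from
above. The sign of a is left undetermined, so only the absolute value converges. -/
lemma tendsto_abs_optimal {q₁ q₂ K : ℝ} (hq₁ : 0 < q₁) (hq₂ : 0 < q₂) (hK : 0 < K) (n₀ : ℕ)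
    {a : ℕ → ℝ} (ha : ∀ᶠ n in atTop, a n ∈ feasibleSet q₁ q₂ K n₀ n ∧
      IsMinOn (objective q₁ q₂ n₀ n) (feasibleSet q₁ q₂ K n₀ n) (a n)) :
    Tendsto (fun n => |rmseScale q₁ q₂ n₀ n * a n|) atTop
      (𝓝 √(2 * rmseExp q₁ q₂ / K ^ (2 * (q₁ + q₂)))) := by
  have hβ := rmseExp_pos hq₁ hq₂
  have hγ := two_mul_rmseExp_lt_one hq₁ hq₂
  have hκ : 0 < K ^ (2 * (q₁ + q₂)) := by positivity
  set β := rmseExp q₁ q₂ with hβd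
  set κ := K ^ (2 * (q₁ + q₂)) with hκd
  set T := rmseScale q₁ q₂ n₀ with hTd
  have hTpos : ∀ᶠ n in atTop, 0 < T n := (tendsto_rmseScale hq₁ hq₂ n₀).eventually_gt_atTop 0
  have hQ := tendsto_phiSum_variance hq₁ hq₂ n₀
  have hlow : ∀ᶠ n in atTop, (phiSum n₀ n (1 - 2 * β) / T n ^ 2)⁻¹ ≤
      T n ^ 2 * noiseFactor q₁ q₂ n₀ n (a n) := by
    filter_upwards [hTpos, eventually_gt_atTop 0, eventually_gramDet_pos hq₁ hq₂ n₀]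
      with n h1 h2 h3
    have := inv_phiSum_le_noiseFactor hq₁ hq₂ h2 h3 (a n)
    rw [inv_div, div_eq_mul_inv]
    gcongr
  rw [tendsto_order]
  constructor
  · intro l hl
    have h1 : Tendsto (fun n => √((phiSum n₀ n (1 - 2 * β) / T n ^ 2)⁻¹ / κ)) atTop
        (𝓝 √(2 * β / κ)) := by
      have := (hQ.inv₀ (by positivity)).div_const κ
      rw [one_div, inv_inv] at this
      exact this.sqrt
    filter_upwards [h1.eventually_const_lt hl, hlow, ha] with n h1 h2 h3
    refine h1.trans_le ?_
    rw [← Real.sqrt_sq_eq_abs]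
    apply Real.sqrt_le_sqrt
    rw [div_le_iff₀ hκ]
    have h4 := mem_feasibleSet.1 h3.1
    calc _ ≤ _ := h2
      _ ≤ T n ^ 2 * (κ * a n ^ 2) := by gcongr
      _ = _ := by ring
  · intro l hl
    -- The competitor u/T with u just above the limit is eventually feasible, and its objective,
    -- scaled by T^(2(1-2β))φ(1-2β)^(2β), tends to u^(2(1-2β)).
    obtain ⟨u, hu1, hu2⟩ := exists_between hl
    have hu0 : 0 < u := (Real.sqrt_nonneg _).trans_lt hu1
    have huf : 2 * β < κ * u ^ 2 := by
      have := (Real.sqrt_lt' hu0).1 hu1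
      rw [div_lt_iff₀ hκ] at this
      linarith
    have hlim : Tendsto (fun n => u ^ (2 * (1 - 2 * β)) *
        ((phiSum n₀ n (1 - 2 * β) / T n ^ 2) *
          (T n ^ 2 * noiseFactor q₁ q₂ n₀ n (u / T n))) ^ (2 * β)) atTop
        (𝓝 (u ^ (2 * (1 - 2 * β)))) := by
      have h1 := hQ.mul (tendsto_noiseFactor hq₁ hq₂ n₀ u)
      rw [one_div, inv_mul_cancel₀ (by positivity)] at h1
      have h2 := (h1.rpow_const (p := 2 * β) (Or.inl one_ne_zero)).const_mul
        (u ^ (2 * (1 - 2 * β)))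
      simpa using h2
    have hul : u ^ (2 * (1 - 2 * β)) < l ^ (2 * (1 - 2 * β)) :=
      Real.rpow_lt_rpow hu0.le hu2 (by linarith)
    filter_upwards [hlim.eventually_lt_const hul, hTpos, hlow, ha, eventually_gt_atTop 0,
      eventually_gramDet_pos hq₁ hq₂ n₀,
      eventually_mem_feasibleSet hq₁ hq₂ n₀ huf] with n h1 h2 h3 h4 h5 h6 h7
    have hmin : objective q₁ q₂ n₀ n (a n) ≤ objective q₁ q₂ n₀ n (u / T n) := h4.2 h7
    rw [objective_eq hq₁ hq₂, objective_eq hq₁ hq₂] at hmin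
    set φ := phiSum n₀ n (1 - 2 * β) with hφ
    have hφ0 : 0 < φ := phiSum_pos n₀ h5 _
    have hna : φ⁻¹ ≤ noiseFactor q₁ q₂ n₀ n (a n) := inv_phiSum_le_noiseFactor hq₁ hq₂ h5 h6 _
    have hnu : φ⁻¹ ≤ noiseFactor q₁ q₂ n₀ n (u / T n) :=
      inv_phiSum_le_noiseFactor hq₁ hq₂ h5 h6 _
    have hφi : 0 < φ⁻¹ := by positivity
    -- If |T a| ≥ l, the lower bound on the noise would make the scaled objective at a at least
    -- l^(2(1-2β)), beyond that of the competitor.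
    refine lt_of_not_ge fun hle => absurd h1 (not_lt.2 ?_)
    calc l ^ (2 * (1 - 2 * β)) ≤ |T n * a n| ^ (2 * (1 - 2 * β)) :=
          Real.rpow_le_rpow (hu0.le.trans hu2.le) hle (by linarith)
      _ = T n ^ (2 * (1 - 2 * β)) * φ ^ (2 * β) *
            (|a n| ^ (2 * (1 - 2 * β)) * φ⁻¹ ^ (2 * β)) := by
          rw [abs_mul, abs_of_pos h2, Real.mul_rpow h2.le (abs_nonneg _), Real.inv_rpow hφ0.le]
          have := Real.rpow_pos_of_pos hφ0 (2 * β)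
          field_simp
      _ ≤ T n ^ (2 * (1 - 2 * β)) * φ ^ (2 * β) *
            (|a n| ^ (2 * (1 - 2 * β)) * noiseFactor q₁ q₂ n₀ n (a n) ^ (2 * β)) := by gcongr
      _ ≤ T n ^ (2 * (1 - 2 * β)) * φ ^ (2 * β) * (|u / T n| ^ (2 * (1 - 2 * β)) *
            noiseFactor q₁ q₂ n₀ n (u / T n) ^ (2 * β)) := by gcongr
      _ = _ := by
          have e : φ / T n ^ 2 * (T n ^ 2 * noiseFactor q₁ q₂ n₀ n (u / T n)) =
            φ * noiseFactor q₁ q₂ n₀ n (u / T n) := by field_simp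
          rw [e, Real.mul_rpow hφ0.le (hφi.le.trans hnu), abs_of_pos (by positivity),
            Real.div_rpow hu0.le h2.le]
          have := Real.rpow_pos_of_pos h2 (2 * (1 - 2 * β))
          field_simp

/-! ### Limits of the scaled mean squared errors. -/

lemma tendsto_tuning {q₁ q₂ d : ℝ} (hq₁ : 0 < q₁) (hq₂ : 0 < q₂) (hd : 0 < d) {x : ℕ → ℝ}
    (hx : Tendsto x atTop atTop) :
    Tendsto (fun i => d * x i ^ (-rateExp q₁ q₂)) atTop (𝓝[>] 0) := by
  have hα : 0 < rateExp q₁ q₂ := by unfold rateExp; positivity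
  rw [tendsto_nhdsWithin_iff]
  constructor
  · simpa using ((tendsto_rpow_neg_atTop hα).comp hx).const_mul d
  · filter_upwards [hx.eventually_gt_atTop 0] with i hi
    exact mul_pos hd (Real.rpow_pos_of_pos hi _)

lemma tendsto_bias_tuning {q₁ q₂ d B : ℝ} (hq₁ : 0 < q₁) (hq₂ : 0 < q₂) (hd : 0 < d)
    {b : ℝ → ℝ} (hb : (fun δ : ℝ => b δ - B * δ ^ q₁) =o[𝓝[>] 0] (fun δ : ℝ => δ ^ q₁))
    {x : ℕ → ℝ} (hx : Tendsto x atTop atTop) :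
    Tendsto (fun i => b (d * x i ^ (-rateExp q₁ q₂)) * x i ^ rmseExp q₁ q₂) atTop
      (𝓝 (B * d ^ q₁)) := by
  have h := ((hb.tendsto_div_nhds_zero.comp (tendsto_tuning hq₁ hq₂ hd hx)).add_const B).mul_const
    (d ^ q₁)
  rw [zero_add] at h
  refine h.congr' ?_
  filter_upwards [hx.eventually_gt_atTop 0] with i hi
  have h1 : (d * x i ^ (-rateExp q₁ q₂)) ^ q₁ = d ^ q₁ / x i ^ rmseExp q₁ q₂ := by
    rw [Real.mul_rpow hd.le (by positivity), ← Real.rpow_mul hi.le, neg_mul,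
      rateExp_mul_left hq₁ hq₂, Real.rpow_neg hi.le, div_eq_mul_inv]
  simp only [Function.comp, h1]
  have := Real.rpow_pos_of_pos hi (rmseExp q₁ q₂)
  have := Real.rpow_pos_of_pos hd q₁
  field_simp
  ring

lemma tuning_rpow_sq {q₁ q₂ d x : ℝ} (hq₁ : 0 < q₁) (hq₂ : 0 < q₂) (hd : 0 < d) (hx : 0 < x) :
    ((d * x ^ (-rateExp q₁ q₂)) ^ q₂) ^ 2 = (d ^ q₂) ^ 2 / x ^ (1 - 2 * rmseExp q₁ q₂) := by
  rw [Real.mul_rpow hd.le (by positivity), ← Real.rpow_mul hx.le, neg_mul,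
    rateExp_mul_right hq₁ hq₂, mul_pow, ← Real.rpow_natCast (x ^ _) 2, ← Real.rpow_mul hx.le,
    div_eq_mul_inv ((d ^ q₂) ^ 2), ← Real.rpow_neg hx.le]
  congr 2
  push_cast
  ring

lemma tendsto_variance_tuning {q₁ q₂ d v₀ : ℝ} (hq₁ : 0 < q₁) (hq₂ : 0 < q₂) (hd : 0 < d)
    {v : ℝ → ℝ} (hv : Tendsto v (𝓝[>] 0) (𝓝 v₀)) {x : ℕ → ℝ} (hx : Tendsto x atTop atTop) :
    Tendsto (fun i => v (d * x i ^ (-rateExp q₁ q₂)) /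
      ((d * x i ^ (-rateExp q₁ q₂)) ^ q₂) ^ 2 / x i ^ (1 - 2 * rmseExp q₁ q₂)) atTop
      (𝓝 (v₀ / (d ^ q₂) ^ 2)) := by
  refine ((hv.comp (tendsto_tuning hq₁ hq₂ hd hx)).div_const ((d ^ q₂) ^ 2)).congr' ?_
  filter_upwards [hx.eventually_gt_atTop 0] with i hi
  rw [tuning_rpow_sq hq₁ hq₂ hd hi]
  have := Real.rpow_pos_of_pos hi (1 - 2 * rmseExp q₁ q₂)
  simp only [Function.comp]
  field_simp

/-- The baseline is asymptotically `(n + n₀) ^ (-2 β)` times a constant. -/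
lemma tendsto_baseline {q₁ q₂ d B v₀ : ℝ} (hq₁ : 0 < q₁) (hq₂ : 0 < q₂) (hd : 0 < d) (n₀ : ℕ)
    {M : SimOutput}
    (hb : (fun δ : ℝ => M.bias δ - B * δ ^ q₁) =o[𝓝[>] 0] (fun δ : ℝ => δ ^ q₁))
    (hv : Tendsto (fun δ : ℝ => variance (fun e : ℝ => e) (M.noise δ : Measure ℝ))
            (𝓝[>] 0) (𝓝 v₀)) :
    Tendsto (fun n => rmseScale q₁ q₂ n₀ n ^ 2 * biasVarianceMSE M q₂ (n := n)
        (fun _ => d * ((n : ℝ) + n₀) ^ (-rateExp q₁ q₂)) (fun _ => 1 / (n : ℝ))) atTop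
      (𝓝 ((B * d ^ q₁) ^ 2 + v₀ / (d ^ q₂) ^ 2)) := by
  have hx := tendsto_natCast_add_atTop n₀
  have h1 := (tendsto_bias_tuning hq₁ hq₂ hd hb hx).pow 2
  have h2 := tendsto_variance_tuning hq₁ hq₂ hd hv hx
  have h3 : Tendsto (fun n : ℕ => ((n : ℝ) + n₀) / n) atTop (𝓝 1) := by
    have := (tendsto_const_nhds (x := (n₀ : ℝ))).div_atTop
      (tendsto_natCast_atTop_atTop (R := ℝ))
    have := this.const_add 1
    rw [add_zero] at this
    refine this.congr' ?_
    filter_upwards [eventually_gt_atTop 0] with n hn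
    field_simp
  have h4 := h1.add (h2.mul h3)
  rw [mul_one] at h4
  refine h4.congr' ?_
  filter_upwards [eventually_gt_atTop 0] with n hn
  have hn' : (n : ℝ) ≠ 0 := by positivity
  have hN : 0 < (n : ℝ) + n₀ := by positivity
  simp only [biasVarianceMSE, Finset.sum_const, Finset.card_univ, Fintype.card_fin, nsmul_eq_mul]
  have e1 : (n : ℝ) * (1 / n) = 1 := by field_simp
  have e2 : ((n : ℝ) + n₀) = ((n : ℝ) + n₀) ^ (1 - 2 * rmseExp q₁ q₂) *
      rmseScale q₁ q₂ n₀ n ^ 2 := by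
    rw [rmseScale_sq, ← Real.rpow_add hN]
    simp
  have e3 : ((n : ℝ) + n₀) / n = ((n : ℝ) + n₀) ^ (1 - 2 * rmseExp q₁ q₂) *
      rmseScale q₁ q₂ n₀ n ^ 2 / n := by rw [← e2]
  rw [e1, e3]
  have e4 : ((n : ℝ) + n₀) ^ rmseExp q₁ q₂ = rmseScale q₁ q₂ n₀ n := rfl
  rw [e4]
  have := Real.rpow_pos_of_pos hN (1 - 2 * rmseExp q₁ q₂)
  generalize (variance (fun e : ℝ => e)
    (M.noise (d * ((n : ℝ) + n₀) ^ (-rateExp q₁ q₂)) : Measure ℝ)) = V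
  generalize M.bias (d * ((n : ℝ) + n₀) ^ (-rateExp q₁ q₂)) = b
  generalize ((d * ((n : ℝ) + n₀) ^ (-rateExp q₁ q₂)) ^ q₂) ^ 2 = D
  generalize ((n : ℝ) + n₀) ^ (1 - 2 * rmseExp q₁ q₂) = X at *
  simp only [div_eq_mul_inv]
  field_simp
  ring

/-- Two-decay weights, with a scaled bias factor whose absolute value converges, have an
asymptotic mean squared error that does not depend on the target. -/
lemma tendsto_twoDecay {q₁ q₂ d B v₀ U : ℝ} (hq₁ : 0 < q₁) (hq₂ : 0 < q₂) (hd : 0 < d) (n₀ : ℕ)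
    {M : SimOutput}
    (hb : (fun δ : ℝ => M.bias δ - B * δ ^ q₁) =o[𝓝[>] 0] (fun δ : ℝ => δ ^ q₁))
    (hv : Tendsto (fun δ : ℝ => variance (fun e : ℝ => e) (M.noise δ : Measure ℝ))
            (𝓝[>] 0) (𝓝 v₀))
    {a : ℕ → ℝ} (ha : Tendsto (fun n => |rmseScale q₁ q₂ n₀ n * a n|) atTop (𝓝 U))
    {W : WeightArray} (hW : ∀ᶠ n in atTop, ∀ i : Fin n,
      W n i = (xiMatrix q₁ q₂ n₀ n).mulVec ![a n, 1] 0
                / (((i : ℝ) + 1) + n₀) ^ ((q₁ + 2 * q₂) / (2 * (q₁ + q₂)))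
            + (xiMatrix q₁ q₂ n₀ n).mulVec ![a n, 1] 1
                / (((i : ℝ) + 1) + n₀) ^ (q₂ / (q₁ + q₂))) :
    Tendsto (fun n => rmseScale q₁ q₂ n₀ n ^ 2 * biasVarianceMSE M q₂
        (fun i : Fin n => d * (((i : ℝ) + 1) + n₀) ^ (-rateExp q₁ q₂)) (W n)) atTop
      (𝓝 (U ^ 2 * (B * d ^ q₁) ^ 2 + 2 * rmseExp q₁ q₂ * (v₀ / (d ^ q₂) ^ 2))) := by
  have hβ := rmseExp_pos hq₁ hq₂
  have hγ := two_mul_rmseExp_lt_one hq₁ hq₂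
  set β := rmseExp q₁ q₂ with hβd
  set T := rmseScale q₁ q₂ n₀ with hTd
  have hT : Tendsto T atTop atTop := tendsto_rmseScale hq₁ hq₂ n₀
  have hTpos : ∀ᶠ n in atTop, 0 < T n := hT.eventually_gt_atTop 0
  have hL := tendsto_phiSum_one n₀
  have hP := tendsto_phiSum n₀ hβ (by linarith)
  have hQ := tendsto_phiSum n₀ (s := 2 * β) (by linarith) hγ.le
  have hx : Tendsto (fun i : ℕ => ((i : ℝ) + 1) + n₀) atTop atTop :=
    tendsto_atTop_add_const_right _ _
      (tendsto_atTop_add_const_right _ _ tendsto_natCast_atTop_atTop)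
  have hPT : Tendsto (fun n => phiSum n₀ n (1 - β) / T n) atTop (𝓝 (1 / β)) :=
    tendsto_phiSum_bias hq₁ hq₂ n₀
  have hQT : Tendsto (fun n => phiSum n₀ n (1 - 2 * β) / T n ^ 2) atTop (𝓝 (1 / (2 * β))) :=
    tendsto_phiSum_variance hq₁ hq₂ n₀
  set b₀ := B * d ^ q₁
  set s₀ := v₀ / (d ^ q₂) ^ 2
  set δ : ℕ → ℝ := fun i => d * (((i : ℝ) + 1) + n₀) ^ (-rateExp q₁ q₂) with hδ
  set b : ℕ → ℝ := fun i => M.bias (δ i) * (((i : ℝ) + 1) + n₀) ^ β with hbd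
  set s : ℕ → ℝ := fun i => variance (fun e : ℝ => e) (M.noise (δ i) : Measure ℝ) /
      (δ i ^ q₂) ^ 2 / (((i : ℝ) + 1) + n₀) ^ (1 - 2 * β) with hsd
  have hblim : Tendsto b atTop (𝓝 b₀) := tendsto_bias_tuning hq₁ hq₂ hd hb hx
  have hslim : Tendsto s atTop (𝓝 s₀) := tendsto_variance_tuning hq₁ hq₂ hd hv hx
  have hb1 := tendsto_sum_div_phiSum n₀ hL hblim
  have hb2 := tendsto_sum_div_phiSum n₀ hP hblim
  have hs1 := tendsto_sum_div_phiSum n₀ hL hslim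
  have hs2 := tendsto_sum_div_phiSum n₀ hP hslim
  have hs3 := tendsto_sum_div_phiSum n₀ hQ hslim
  set u : ℕ → ℝ := fun n => T n * a n with hu
  -- The sequence u = T a may oscillate in sign, so below it enters only through its boundedness.
  have hubdd : IsBoundedUnder (· ≤ ·) atTop (norm ∘ u) := ha.isBoundedUnder_le
  set l₁ : ℕ → ℝ := fun n => (xiMatrix q₁ q₂ n₀ n).mulVec ![a n, 1] 0 with hl₁
  set l₂ : ℕ → ℝ := fun n => (xiMatrix q₁ q₂ n₀ n).mulVec ![a n, 1] 1 with hl₂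
  have hl₁e : ∀ n, l₁ n = xiMatrix q₁ q₂ n₀ n 0 0 * a n + xiMatrix q₁ q₂ n₀ n 0 1 := by
    intro n; simp [hl₁, Matrix.mulVec, dotProduct, Fin.sum_univ_two]
  have hl₂e : ∀ n, l₂ n = xiMatrix q₁ q₂ n₀ n 0 1 * a n + xiMatrix q₁ q₂ n₀ n 1 1 := by
    intro n; simp [hl₂, Matrix.mulVec, dotProduct, Fin.sum_univ_two, xiMatrix_one_zero hq₁ hq₂]
  have hm : Tendsto (fun n => T n ^ 2 * l₂ n) atTop (𝓝 (2 * β)) := by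
    have h1 := (tendsto_xiMatrix_zero_one hq₁ hq₂ n₀).zero_mul_isBoundedUnder_le hubdd
    have h2 := h1.add (tendsto_mul_xiMatrix_one_one hq₁ hq₂ n₀)
    rw [zero_add] at h2
    refine h2.congr fun n => ?_
    rw [hl₂e]
    simp only [hu]
    ring
  have hk : Tendsto (fun n => phiSum n₀ n 1 * (T n * l₁ n) - u n) atTop (𝓝 (-2)) := by
    have h0 : Tendsto (fun n => phiSum n₀ n 1 * xiMatrix q₁ q₂ n₀ n 0 0 - 1) atTop (𝓝 0) := by
      simpa using (tendsto_mul_xiMatrix_zero_zero hq₁ hq₂ n₀).sub_const 1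
    have h2 := (h0.zero_mul_isBoundedUnder_le hubdd).add
      (tendsto_mul_xiMatrix_zero_one hq₁ hq₂ n₀)
    rw [zero_add] at h2
    refine h2.congr fun n => ?_
    rw [hl₁e]
    simp only [hu]
    ring
  have hmP : Tendsto (fun n => T n ^ 2 * l₂ n * (phiSum n₀ n (1 - β) / T n)) atTop (𝓝 2) := by
    have := hm.mul hPT
    have e : 2 * β * (1 / β) = 2 := by field_simp
    rwa [e] at this
  -- The first decay contributes (u - 2)b₀ and the second 2b₀, up to o(1).
  have hbias : Tendsto (fun n => T n * ∑ i : Fin n, W n i * M.bias (δ i) - u n * b₀) atTop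
      (𝓝 0) := by
    have h1 : Tendsto (fun n => (∑ i : Fin n, b i * (1 / (((i : ℝ) + 1) + n₀) ^ (1 : ℝ))) /
        phiSum n₀ n 1 - b₀) atTop (𝓝 0) := by simpa using hb1.sub_const b₀
    have h2 := h1.zero_mul_isBoundedUnder_le hubdd
    have h3 := ((hk.mul hb1).add (hmP.mul hb2)).add h2
    have e : -2 * b₀ + 2 * b₀ + 0 = 0 := by ring
    rw [e] at h3
    refine h3.congr' ?_
    filter_upwards [hW, hTpos, hL.eventually_gt_atTop 0, hP.eventually_gt_atTop 0]
      with n hn hT0 hL0 hP0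
    rw [one_sub_rmseExp hq₁ hq₂, one_sub_two_mul_rmseExp hq₁ hq₂] at hn
    have e1 : ∑ i : Fin n, W n i * M.bias (δ i) =
        l₁ n * ∑ i : Fin n, b i * (1 / (((i : ℝ) + 1) + n₀) ^ (1 : ℝ)) +
        l₂ n * ∑ i : Fin n, b i * (1 / (((i : ℝ) + 1) + n₀) ^ (1 - β)) := by
      rw [Finset.mul_sum, Finset.mul_sum, ← Finset.sum_add_distrib]
      refine Finset.sum_congr rfl fun i _ => ?_
      have hp : 0 < ((i : ℝ) + 1) + n₀ := by positivity
      rw [hn]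
      have hpβ := Real.rpow_pos_of_pos hp β
      have r1 : (((i : ℝ) + 1) + n₀) ^ (1 - β) =
          (((i : ℝ) + 1) + n₀) ^ (1 : ℝ) / (((i : ℝ) + 1) + n₀) ^ β := Real.rpow_sub hp _ _
      have r2 : (((i : ℝ) + 1) + n₀) ^ (1 - 2 * β) =
          (((i : ℝ) + 1) + n₀) ^ (1 - β) / (((i : ℝ) + 1) + n₀) ^ β := by
        rw [← Real.rpow_sub hp]; congr 1; ring
      change (l₁ n / _ + l₂ n / _) * _ = _
      simp only [hbd]
      rw [← hβd, r2, r1]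
      field_simp
    rw [e1]
    field_simp
    ring
  -- T l₁ is O(1/φ(1)), because φ(1) T l₁ differs from the bounded u by a convergent sequence.
  have hk0 : Tendsto (fun n => T n * l₁ n) atTop (𝓝 0) := by
    have h1 := (hubdd.isBigO_one ℝ).add (hk.isBigO_one ℝ)
    have h2 : (fun n => phiSum n₀ n 1 * (T n * l₁ n)) =O[atTop] (fun _ => (1 : ℝ)) := by
      refine h1.congr_left fun n => by ring
    have h3 := (tendsto_inv_atTop_zero.comp hL).zero_mul_isBoundedUnder_le
      h2.isBoundedUnder_le
    refine h3.congr' ?_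
    filter_upwards [hL.eventually_gt_atTop 0] with n hL0
    simp only [Function.comp]
    field_simp
  have hkL : Tendsto (fun n => (T n * l₁ n) * (phiSum n₀ n 1 * (T n * l₁ n))) atTop (𝓝 0) := by
    have h1 := (hubdd.isBigO_one ℝ).add (hk.isBigO_one ℝ)
    have h2 : (fun n => phiSum n₀ n 1 * (T n * l₁ n)) =O[atTop] (fun _ => (1 : ℝ)) := by
      refine h1.congr_left fun n => by ring
    exact hk0.zero_mul_isBoundedUnder_le h2.isBoundedUnder_le
  have hvar : Tendsto (fun n => T n ^ 2 * ∑ i : Fin n, W n i ^ 2 *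
      (variance (fun e : ℝ => e) (M.noise (δ i) : Measure ℝ) / (δ i ^ q₂) ^ 2)) atTop
      (𝓝 (2 * β * s₀)) := by
    -- Expanding the squared weights, only l₂²φ(1-2β) survives, with limit (2β)²/(2β) = 2β; the
    -- other terms carry a factor T l₁ → 0.
    have h3 := ((hkL.mul hs1).add (((hk0.mul hmP).const_mul 2).mul hs2)).add
      (((hm.pow 2).mul hQT).mul hs3)
    have e : 0 * s₀ + 2 * (0 * 2) * s₀ + (2 * β) ^ 2 * (1 / (2 * β)) * s₀ =
        2 * β * s₀ := by field_simp; ring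
    rw [e] at h3
    refine h3.congr' ?_
    filter_upwards [hW, hTpos, hL.eventually_gt_atTop 0, hP.eventually_gt_atTop 0,
      hQ.eventually_gt_atTop 0] with n hn hT0 hL0 hP0 hQ0
    rw [one_sub_rmseExp hq₁ hq₂, one_sub_two_mul_rmseExp hq₁ hq₂] at hn
    have e1 : ∑ i : Fin n, W n i ^ 2 *
        (variance (fun e : ℝ => e) (M.noise (δ i) : Measure ℝ) / (δ i ^ q₂) ^ 2) =
        l₁ n ^ 2 * ∑ i : Fin n, s i * (1 / (((i : ℝ) + 1) + n₀) ^ (1 : ℝ)) +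
        2 * l₁ n * l₂ n * ∑ i : Fin n, s i * (1 / (((i : ℝ) + 1) + n₀) ^ (1 - β)) +
        l₂ n ^ 2 * ∑ i : Fin n, s i * (1 / (((i : ℝ) + 1) + n₀) ^ (1 - 2 * β)) := by
      rw [Finset.mul_sum, Finset.mul_sum, Finset.mul_sum, ← Finset.sum_add_distrib,
        ← Finset.sum_add_distrib]
      refine Finset.sum_congr rfl fun i _ => ?_
      have hp : 0 < ((i : ℝ) + 1) + n₀ := by positivity
      rw [hn]
      have hpβ := Real.rpow_pos_of_pos hp β
      have r1 : (((i : ℝ) + 1) + n₀) ^ (1 - β) =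
          (((i : ℝ) + 1) + n₀) ^ (1 : ℝ) / (((i : ℝ) + 1) + n₀) ^ β := Real.rpow_sub hp _ _
      have r2 : (((i : ℝ) + 1) + n₀) ^ (1 - 2 * β) =
          (((i : ℝ) + 1) + n₀) ^ (1 - β) / (((i : ℝ) + 1) + n₀) ^ β := by
        rw [← Real.rpow_sub hp]; congr 1; ring
      change (l₁ n / _ + l₂ n / _) ^ 2 * _ = _
      simp only [hsd]
      generalize variance (fun e : ℝ => e) (M.noise (δ i) : Measure ℝ) / (δ i ^ q₂) ^ 2 = V
      rw [← hβd, r2, r1, Real.rpow_one]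
      generalize (((i : ℝ) + 1) + n₀) ^ β = y at *
      generalize ((i : ℝ) + 1) + n₀ = z at *
      field_simp
      ring
    rw [e1]
    field_simp
  have hbias2 : Tendsto (fun n => (T n * ∑ i : Fin n, W n i * M.bias (δ i)) ^ 2) atTop
      (𝓝 (U ^ 2 * b₀ ^ 2)) := by
    have h1 := (hbias.zero_mul_isBoundedUnder_le hubdd).const_mul (2 * b₀)
    have h2 := ((ha.pow 2).mul_const (b₀ ^ 2)).add ((hbias.pow 2).add h1)
    have e : U ^ 2 * b₀ ^ 2 + (0 ^ 2 + 2 * b₀ * 0) = U ^ 2 * b₀ ^ 2 := by ring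
    rw [e] at h2
    refine h2.congr fun n => ?_
    rw [sq_abs]
    simp only [hu]
    ring
  refine (hbias2.add hvar).congr' ?_
  filter_upwards [hW, eventually_gramDet_pos hq₁ hq₂ n₀] with n hn hD
  have hsum : ∑ i, W n i = 1 := by
    rw [one_sub_rmseExp hq₁ hq₂, one_sub_two_mul_rmseExp hq₁ hq₂] at hn
    have : ∑ i, W n i = l₁ n * phiSum n₀ n (1 - β) + l₂ n * phiSum n₀ n (1 - 2 * β) := by
      rw [phiSum, phiSum, Finset.mul_sum, Finset.mul_sum, ← Finset.sum_add_distrib]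
      refine Finset.sum_congr rfl fun i _ => ?_
      rw [hn]
      change l₁ n / _ + l₂ n / _ = _
      rw [mul_one_div, mul_one_div]
    rw [this, hl₁e, hl₂e]
    simp only [xiMatrix_eq hq₁ hq₂, Matrix.of_apply, Matrix.cons_val',
      Matrix.cons_val_zero, Matrix.cons_val_fin_one, Matrix.cons_val_one]
    have hDe : gramDet q₁ q₂ n₀ n = phiSum n₀ n 1 * phiSum n₀ n (1 - 2 * rmseExp q₁ q₂) -
      phiSum n₀ n (1 - rmseExp q₁ q₂) ^ 2 := rfl
    field_simp
    rw [hDe]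
    ring
  simp only [biasVarianceMSE, hsum]
  ring

lemma generalMSE_eq {q₁ q₂ d : ℝ} (hd : 0 < d) (n₀ : ℕ) {M : SimOutput} (hM : M ∈ modelClass q₁)
    {n : ℕ} (w : Fin n → ℝ) :
    generalMSE M q₁ q₂ n₀ d w = ENNReal.ofReal (biasVarianceMSE M q₂
      (fun i : Fin n => d * (((i : ℝ) + 1) + n₀) ^ (-rateExp q₁ q₂)) w) := by
  have hδ : ∀ i : Fin n, 0 < d * (((i : ℝ) + 1) + n₀) ^ (-rateExp q₁ q₂) := fun i => by positivity
  exact weightedMSE_eq M q₂ _ w (fun i => (hM.2.1 _ (hδ i)).1) (fun i => (hM.2.1 _ (hδ i)).2)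

lemma baselineMSE_eq {q₁ q₂ d : ℝ} (hd : 0 < d) (n₀ : ℕ) {M : SimOutput} (hM : M ∈ modelClass q₁)
    {n : ℕ} (hn : 0 < n) :
    baselineMSE M q₁ q₂ n₀ d n = ENNReal.ofReal (biasVarianceMSE M q₂ (n := n)
      (fun _ => d * ((n : ℝ) + n₀) ^ (-rateExp q₁ q₂)) (fun _ => 1 / (n : ℝ))) := by
  have hδ : 0 < d * ((n : ℝ) + n₀) ^ (-rateExp q₁ q₂) := by positivity
  exact weightedMSE_eq M q₂ _ _ (fun _ => (hM.2.1 _ hδ).1) (fun _ => (hM.2.1 _ hδ).2)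

/-- With inflation factor `K`, the risk ratio of two-decay weights is the same for all models. -/
lemma riskRatio_twoDecay {q₁ q₂ K d : ℝ} (hq₁ : 0 < q₁) (hq₂ : 0 < q₂) (hK : 0 < K) (hd : 0 < d)
    (n₀ : ℕ) {W : WeightArray} (hW : IsTwoDecayArray q₁ q₂ K n₀ W)
    {M : SimOutput} (hM : M ∈ modelClass q₁) :
    riskRatio M q₁ q₂ n₀ d (K * d) W =
      ENNReal.ofReal (q₁ / (q₁ + q₂) * (1 / K ^ (2 * q₂))) := by
  have hβ := rmseExp_pos hq₁ hq₂
  have hKd : 0 < K * d := by positivity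
  obtain ⟨⟨B, hB, hb⟩, -, ⟨v₀, hv₀, hv⟩⟩ := id hM
  obtain ⟨a, ha⟩ := Filter.Eventually.choice hW
  have hopt := tendsto_abs_optimal hq₁ hq₂ hK n₀
    (ha.mono fun n h => ⟨h.1, h.2.1⟩)
  have hG := tendsto_twoDecay hq₁ hq₂ hKd n₀ hb hv hopt (ha.mono fun n h => h.2.2)
  have hH := tendsto_baseline hq₁ hq₂ hd n₀ hb hv
  have hpos : 0 < (B * d ^ q₁) ^ 2 + v₀ / (d ^ q₂) ^ 2 := by positivity
  have hlim := hG.div hH hpos.ne'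
  -- K^(2q₁) from the bias cancels against K^(2(q₁+q₂)), so numerator and denominator are
  -- proportional whatever B and v₀ are.
  have hval : (√(2 * rmseExp q₁ q₂ / K ^ (2 * (q₁ + q₂))) ^ 2 * (B * (K * d) ^ q₁) ^ 2 +
      2 * rmseExp q₁ q₂ * (v₀ / ((K * d) ^ q₂) ^ 2)) /
      ((B * d ^ q₁) ^ 2 + v₀ / (d ^ q₂) ^ 2) = q₁ / (q₁ + q₂) * (1 / K ^ (2 * q₂)) := by
    rw [Real.sq_sqrt (by positivity), ← two_mul_rmseExp hq₁ hq₂, div_eq_iff hpos.ne',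
      Real.mul_rpow hK.le hd.le, Real.mul_rpow hK.le hd.le]
    have e1 : K ^ (2 * (q₁ + q₂)) = (K ^ q₁) ^ 2 * (K ^ q₂) ^ 2 := by
      rw [← Real.rpow_natCast (K ^ q₁), ← Real.rpow_natCast (K ^ q₂), ← Real.rpow_mul hK.le,
        ← Real.rpow_mul hK.le, ← Real.rpow_add hK]
      congr 1; push_cast; ring
    have e2 : K ^ (2 * q₂) = (K ^ q₂) ^ 2 := by
      rw [← Real.rpow_natCast (K ^ q₂), ← Real.rpow_mul hK.le]
      congr 1; push_cast; ring
    rw [e1, e2]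
    have := Real.rpow_pos_of_pos hK q₁
    have := Real.rpow_pos_of_pos hK q₂
    have := Real.rpow_pos_of_pos hd q₁
    have := Real.rpow_pos_of_pos hd q₂
    field_simp
  rw [hval] at hlim
  refine Tendsto.limsup_eq ((ENNReal.tendsto_ofReal hlim).congr' ?_)
  filter_upwards [hH.eventually_const_lt hpos,
    (tendsto_rmseScale hq₁ hq₂ n₀).eventually_gt_atTop 0, eventually_gt_atTop 0] with n h1 h2 h3
  have h4 := (mul_pos_iff_of_pos_left (by positivity)).1 h1
  rw [generalMSE_eq hKd n₀ hM, baselineMSE_eq hd n₀ hM h3, ← ENNReal.ofReal_div_of_pos h4]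
  congr 1
  simp only [Pi.div_apply]
  rw [mul_div_mul_left _ _ (by positivity)]

/-! ### The lower bound, from Gaussian models. -/

/-- The model with target `θ`, bias `B δ ^ q₁` and standard normal noise. -/
noncomputable def gaussianModel (q₁ θ B : ℝ) : SimOutput where
  θ := θ
  bias δ := B * δ ^ q₁
  noise _ := ⟨gaussianReal 0 1, inferInstance⟩

lemma variance_noise_gaussianModel (q₁ θ B δ : ℝ) :
    variance (fun e : ℝ => e) ((gaussianModel q₁ θ B).noise δ : Measure ℝ) = 1 :=
  variance_fun_id_gaussianReal (μ := 0) (v := 1)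

lemma isLittleO_bias_gaussianModel (q₁ θ B : ℝ) :
    (fun δ : ℝ => (gaussianModel q₁ θ B).bias δ - B * δ ^ q₁) =o[𝓝[>] 0]
      (fun δ : ℝ => δ ^ q₁) := by
  simp [gaussianModel]

lemma tendsto_variance_gaussianModel (q₁ θ B : ℝ) :
    Tendsto (fun δ : ℝ => variance (fun e : ℝ => e)
      ((gaussianModel q₁ θ B).noise δ : Measure ℝ)) (𝓝[>] 0) (𝓝 1) := by
  simp_rw [variance_noise_gaussianModel]
  exact tendsto_const_nhds

lemma gaussianModel_mem_modelClass (q₁ θ : ℝ) {B : ℝ} (hB : B ≠ 0) :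
    gaussianModel q₁ θ B ∈ modelClass q₁ := by
  refine ⟨⟨B, hB, isLittleO_bias_gaussianModel q₁ θ B⟩, fun δ _ => ⟨?_, ?_⟩,
    ⟨1, one_pos, tendsto_variance_gaussianModel q₁ θ B⟩⟩
  · exact memLp_id_gaussianReal (μ := 0) (v := 1) 2
  · exact integral_id_gaussianReal (μ := 0) (v := 1)

/-- Clears the denominator of the extended-real ratio: the scaled baseline has a positive limit, so
it is eventually positive. -/
lemma eventually_lt_of_riskRatio_lt {q₁ q₂ d d' c : ℝ} (hq₁ : 0 < q₁) (hq₂ : 0 < q₂) (hd : 0 < d)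
    (hd' : 0 < d') (n₀ : ℕ) {W : WeightArray} {M : SimOutput} (hM : M ∈ modelClass q₁)
    (h : riskRatio M q₁ q₂ n₀ d d' W < ENNReal.ofReal c) :
    ∀ᶠ n in atTop, rmseScale q₁ q₂ n₀ n ^ 2 * biasVarianceMSE M q₂
        (fun i : Fin n => d' * (((i : ℝ) + 1) + n₀) ^ (-rateExp q₁ q₂)) (W n) <
      c * (rmseScale q₁ q₂ n₀ n ^ 2 * biasVarianceMSE M q₂ (n := n)
        (fun _ => d * ((n : ℝ) + n₀) ^ (-rateExp q₁ q₂)) (fun _ => 1 / (n : ℝ))) := by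
  obtain ⟨⟨B, hB, hb⟩, -, ⟨v₀, hv₀, hv⟩⟩ := id hM
  have hpos : 0 < (B * d ^ q₁) ^ 2 + v₀ / (d ^ q₂) ^ 2 := by positivity
  filter_upwards [eventually_lt_of_limsup_lt h, eventually_gt_atTop 0,
    (tendsto_rmseScale hq₁ hq₂ n₀).eventually_gt_atTop 0,
    (tendsto_baseline hq₁ hq₂ hd n₀ hb hv).eventually_const_lt hpos] with n h1 h2 h3 h4
  have h5 := (mul_pos_iff_of_pos_left (by positivity)).1 h4
  rw [generalMSE_eq hd' n₀ hM, baselineMSE_eq hd n₀ hM h2, ← ENNReal.ofReal_div_of_pos h5,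
    ENNReal.ofReal_lt_ofReal_iff_of_nonneg (div_nonneg (biasVarianceMSE_nonneg _ _ _ _) h5.le),
    div_lt_iff₀ h5] at h1
  have := mul_lt_mul_of_pos_left h1 (pow_pos h3 2)
  linarith

/-- Weights whose risk is bounded on two models with different targets sum to one in the limit. -/
lemma tendsto_sum_weights {q₁ q₂ d d' c : ℝ} (hq₁ : 0 < q₁) (hq₂ : 0 < q₂) (hd : 0 < d)
    (hd' : 0 < d') (n₀ : ℕ) {W : WeightArray}
    (h : ∀ θ, riskRatio (gaussianModel q₁ θ 1) q₁ q₂ n₀ d d' W < ENNReal.ofReal c) :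
    Tendsto (fun n => ∑ i, W n i) atTop (𝓝 1) := by
  set T := rmseScale q₁ q₂ n₀
  have hT : Tendsto T atTop atTop := tendsto_rmseScale hq₁ hq₂ n₀
  have hlt := fun θ => eventually_lt_of_riskRatio_lt hq₁ hq₂ hd hd' n₀
    (gaussianModel_mem_modelClass q₁ θ one_ne_zero) (h θ)
  have hbase := fun θ => (tendsto_baseline hq₁ hq₂ hd n₀ (isLittleO_bias_gaussianModel q₁ θ 1)
    (tendsto_variance_gaussianModel q₁ θ 1)).const_mul c
  have hbd : ∀ θ, ∀ᶠ n in atTop, (T n * (θ * (∑ i, W n i - 1) + ∑ i : Fin n, W n i *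
      (1 * (d' * (((i : ℝ) + 1) + n₀) ^ (-rateExp q₁ q₂)) ^ q₁))) ^ 2 <
      c * ((1 * d ^ q₁) ^ 2 + 1 / (d ^ q₂) ^ 2) + 1 := by
    intro θ
    filter_upwards [hlt θ, (hbase θ).eventually_lt_const (lt_add_one _)] with n h1 h2
    refine lt_of_le_of_lt ?_ (h1.trans h2)
    rw [mul_pow]
    refine mul_le_mul_of_nonneg_left ?_ (sq_nonneg _)
    refine le_add_of_nonneg_right (Finset.sum_nonneg fun i _ => ?_)
    have := variance_nonneg (fun e : ℝ => e) ((gaussianModel q₁ θ 1).noise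
      (d' * (((i : ℝ) + 1) + n₀) ^ (-rateExp q₁ q₂)) : Measure ℝ)
    positivity
  set C := c * ((1 * d ^ q₁) ^ 2 + 1 / (d ^ q₂) ^ 2) + 1
  have hsq : Tendsto (fun n => (∑ i, W n i - 1) ^ 2) atTop (𝓝 0) := by
    have hz : Tendsto (fun n => 4 * C / T n ^ 2) atTop (𝓝 0) :=
      tendsto_const_nhds.div_atTop ((tendsto_pow_atTop two_ne_zero).comp hT)
    refine squeeze_zero' (Eventually.of_forall fun n => sq_nonneg _) ?_ hz
    filter_upwards [hbd 0, hbd 1, hT.eventually_gt_atTop 0] with n h0 h1 hT0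
    rw [le_div_iff₀ (by positivity)]
    set A := ∑ i : Fin n, W n i * (1 * (d' * (((i : ℝ) + 1) + n₀) ^ (-rateExp q₁ q₂)) ^ q₁)
    set S := ∑ i, W n i - 1
    -- With x = T A and y = T(S + A), the difference is T S and (y - x)² ≤ 2x² + 2y² < 4C.
    nlinarith [sq_nonneg (T n * (0 * S + A) + T n * (1 * S + A))]
  have habs : Tendsto (fun n => |∑ i, W n i - 1|) atTop (𝓝 0) := by
    simpa [Real.sqrt_sq_eq_abs] using hsq.sqrt
  have := ((tendsto_zero_iff_abs_tendsto_zero _).2 habs).add_const 1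
  simpa using this

/-- Cauchy-Schwarz; for κ = 1-2β the first factor is the noise factor of the weights. -/
lemma sq_sum_le_mul_phiSum (n₀ : ℕ) {n : ℕ} (w : Fin n → ℝ) (κ : ℝ) :
    (∑ i, w i) ^ 2 ≤ (∑ i : Fin n, w i ^ 2 * (((i : ℝ) + 1) + n₀) ^ κ) * phiSum n₀ n κ := by
  refine Finset.sum_sq_le_sum_mul_sum_of_sq_le_mul Finset.univ
    (fun i _ => by positivity) (fun i _ => by positivity) fun i _ => Eq.le ?_
  have : 0 < (((i : ℝ) + 1) + n₀) ^ κ := by positivity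
  field_simp

/-- The bias is discarded on the left, and B → 0 then removes it from the baseline on the right. -/
lemma le_of_forall_riskRatio_lt {q₁ q₂ d d' c : ℝ} (hq₁ : 0 < q₁) (hq₂ : 0 < q₂) (hd : 0 < d)
    (hd' : 0 < d') (n₀ : ℕ) {W : WeightArray}
    (h : ∀ M ∈ modelClass q₁, riskRatio M q₁ q₂ n₀ d d' W < ENNReal.ofReal c) :
    2 * rmseExp q₁ q₂ * (1 / (d' ^ q₂) ^ 2) ≤ c * (1 / (d ^ q₂) ^ 2) := by
  have hβ := rmseExp_pos hq₁ hq₂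
  have hB : ∀ B : ℝ, B ≠ 0 → 2 * rmseExp q₁ q₂ * (1 / (d' ^ q₂) ^ 2) ≤
      c * ((B * d ^ q₁) ^ 2 + 1 / (d ^ q₂) ^ 2) := by
    intro B hB
    have hS := tendsto_sum_weights hq₁ hq₂ hd hd' n₀
      fun θ => h _ (gaussianModel_mem_modelClass q₁ θ one_ne_zero)
    have hM := gaussianModel_mem_modelClass q₁ 0 hB
    have hbase := (tendsto_baseline hq₁ hq₂ hd n₀ (isLittleO_bias_gaussianModel q₁ 0 B)
      (tendsto_variance_gaussianModel q₁ 0 B)).const_mul c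
    have hlow := ((hS.pow 2).mul ((tendsto_phiSum_variance hq₁ hq₂ n₀).inv₀
      (by positivity))).mul_const (1 / (d' ^ q₂) ^ 2)
    rw [one_pow, one_mul, one_div (2 * _), inv_inv] at hlow
    refine le_of_tendsto_of_tendsto hlow hbase ?_
    filter_upwards [eventually_lt_of_riskRatio_lt hq₁ hq₂ hd hd' n₀ hM (h _ hM),
      eventually_gt_atTop 0,
      (tendsto_rmseScale hq₁ hq₂ n₀).eventually_gt_atTop 0] with n h1 h2 h3
    refine le_trans ?_ h1.le
    have hφ := phiSum_pos n₀ h2 (1 - 2 * rmseExp q₁ q₂)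
    have hcs := sq_sum_le_mul_phiSum n₀ (W n) (1 - 2 * rmseExp q₁ q₂)
    rw [← div_le_iff₀ hφ] at hcs
    have hvar : ∑ i : Fin n, W n i ^ 2 * (variance (fun e : ℝ => e)
        ((gaussianModel q₁ 0 B).noise
          (d' * (((i : ℝ) + 1) + n₀) ^ (-rateExp q₁ q₂)) : Measure ℝ) /
          ((d' * (((i : ℝ) + 1) + n₀) ^ (-rateExp q₁ q₂)) ^ q₂) ^ 2) =
        (∑ i : Fin n, W n i ^ 2 * (((i : ℝ) + 1) + n₀) ^ (1 - 2 * rmseExp q₁ q₂)) *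
          (1 / (d' ^ q₂) ^ 2) := by
      rw [Finset.sum_mul]
      refine Finset.sum_congr rfl fun i _ => ?_
      rw [variance_noise_gaussianModel, tuning_rpow_sq hq₁ hq₂ hd' (by positivity), one_div_div]
      ring
    calc _ = rmseScale q₁ q₂ n₀ n ^ 2 * ((∑ i, W n i) ^ 2 /
            phiSum n₀ n (1 - 2 * rmseExp q₁ q₂) * (1 / (d' ^ q₂) ^ 2)) := by
          rw [inv_div]; ring
      _ ≤ rmseScale q₁ q₂ n₀ n ^ 2 * ((∑ i : Fin n, W n i ^ 2 *
            (((i : ℝ) + 1) + n₀) ^ (1 - 2 * rmseExp q₁ q₂)) * (1 / (d' ^ q₂) ^ 2)) := by gcongr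
      _ ≤ _ := by
          rw [← hvar]
          exact mul_le_mul_of_nonneg_left (le_add_of_nonneg_left (sq_nonneg _)) (sq_nonneg _)
  -- The model class excludes B = 0, so the bias-free inequality is reached only as a limit along
  -- nonzero B, after n → ∞.
  have hlim : Tendsto (fun B : ℝ => c * ((B * d ^ q₁) ^ 2 + 1 / (d ^ q₂) ^ 2)) (𝓝[≠] 0)
      (𝓝 (c * (1 / (d ^ q₂) ^ 2))) := by
    have : Continuous fun B : ℝ => c * ((B * d ^ q₁) ^ 2 + 1 / (d ^ q₂) ^ 2) := by fun_prop
    have h0 := (this.tendsto 0).mono_left (nhdsWithin_le_nhds (s := {0}ᶜ))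
    simpa using h0
  exact ge_of_tendsto hlim (eventually_mem_nhdsWithin.mono fun B hB' => hB B hB')

/-- No admissible calibration and weights have a smaller worst-case risk ratio. -/
lemma le_iSup_riskRatio {q₁ q₂ K d d' : ℝ} (hq₁ : 0 < q₁) (hq₂ : 0 < q₂) (hK : 0 < K)
    (hd : 0 < d) (hd' : 0 < d') (hdK : d' ≤ K * d) (n₀ : ℕ) (W : WeightArray) :
    ENNReal.ofReal (q₁ / (q₁ + q₂) * (1 / K ^ (2 * q₂))) ≤
      ⨆ M ∈ modelClass q₁, riskRatio M q₁ q₂ n₀ d d' W := by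
  by_contra! hlt
  -- A real r strictly between the two sides gives every model the same strict bound, which the
  -- limiting inequality turns into a lower bound on r.
  obtain ⟨r, hr1, hr2⟩ := ENNReal.lt_iff_exists_nnreal_btwn.1 hlt
  rw [← ENNReal.ofReal_coe_nnreal] at hr1 hr2
  have hβ := rmseExp_pos hq₁ hq₂
  have hle := le_of_forall_riskRatio_lt hq₁ hq₂ hd hd' n₀ (W := W) fun M hM =>
    (le_iSup₂ (f := fun M _ => riskRatio M q₁ q₂ n₀ d d' W) M hM).trans_lt hr1
  rw [ENNReal.ofReal_lt_ofReal_iff_of_nonneg r.coe_nonneg] at hr2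
  have hdq := Real.rpow_pos_of_pos hd q₂
  have hdq' := Real.rpow_pos_of_pos hd' q₂
  have hKq := Real.rpow_pos_of_pos hK q₂
  have e2 : K ^ (2 * q₂) = (K ^ q₂) ^ 2 := by
    rw [← Real.rpow_natCast (K ^ q₂), ← Real.rpow_mul hK.le]
    congr 1; push_cast; ring
  have hmono : d' ^ q₂ ≤ K ^ q₂ * d ^ q₂ := by
    rw [← Real.mul_rpow hK.le hd.le]
    exact Real.rpow_le_rpow hd'.le hdK hq₂.le
  have h1 : 2 * rmseExp q₁ q₂ * (1 / (K ^ q₂ * d ^ q₂) ^ 2) ≤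
      2 * rmseExp q₁ q₂ * (1 / (d' ^ q₂) ^ 2) := by gcongr
  have h2 : 2 * rmseExp q₁ q₂ * (1 / (K ^ q₂ * d ^ q₂) ^ 2) =
      q₁ / (q₁ + q₂) * (1 / K ^ (2 * q₂)) * (1 / (d ^ q₂) ^ 2) := by
    rw [e2, two_mul_rmseExp hq₁ hq₂, mul_pow]
    field_simp
  have h3 := h1.trans hle
  rw [h2] at h3
  exact absurd (le_of_mul_le_mul_right h3 (by positivity)) (not_le.2 hr2)

theorem corollary1 (q₁ q₂ K : ℝ) (hq₁ : 0 < q₁) (hq₂ : 0 < q₂) (hK : 0 < K) (n₀ : ℕ)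
    (d : ℝ) (hd : 0 < d) :
    IsLeast
      {r : ℝ≥0∞ | ∃ g ∈ calibrations K, ∃ W : WeightArray,
        r = ⨆ M ∈ modelClass q₁, riskRatio M q₁ q₂ n₀ d (g d) W}
      (ENNReal.ofReal (q₁ / (q₁ + q₂) * (1 / K ^ (2 * q₂)))) ∧
    (∃ W : WeightArray, IsTwoDecayArray q₁ q₂ K n₀ W) ∧
    (∀ W : WeightArray, IsTwoDecayArray q₁ q₂ K n₀ W →
      IsGreatest ((fun M : SimOutput => riskRatio M q₁ q₂ n₀ d (K * d) W) '' modelClass q₁)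
        (ENNReal.ofReal (q₁ / (q₁ + q₂) * (1 / K ^ (2 * q₂))))) := by
  have hgreat : ∀ W : WeightArray, IsTwoDecayArray q₁ q₂ K n₀ W →
      IsGreatest ((fun M : SimOutput => riskRatio M q₁ q₂ n₀ d (K * d) W) '' modelClass q₁)
        (ENNReal.ofReal (q₁ / (q₁ + q₂) * (1 / K ^ (2 * q₂)))) := by
    intro W hW
    refine ⟨⟨_, gaussianModel_mem_modelClass q₁ 0 one_ne_zero,
      riskRatio_twoDecay hq₁ hq₂ hK hd n₀ hW (gaussianModel_mem_modelClass q₁ 0 one_ne_zero)⟩, ?_⟩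
    rintro _ ⟨M, hM, rfl⟩
    exact (riskRatio_twoDecay hq₁ hq₂ hK hd n₀ hW hM).le
  have hex := exists_isTwoDecayArray hq₁ hq₂ hK n₀
  refine ⟨⟨?_, ?_⟩, hex, hgreat⟩
  · obtain ⟨W, hW⟩ := hex
    refine ⟨fun x => K * x, fun x hx => ⟨mul_pos hK hx, le_rfl⟩, W, ?_⟩
    rw [← sSup_image]
    exact (hgreat W hW).isLUB.sSup_eq.symm
  · rintro _ ⟨g, hg, W, rfl⟩
    exact le_iSup_riskRatio hq₁ hq₂ hK hd (hg d hd).1 (hg d hd).2 n₀ W
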